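/- Let $\mathfrak g$ be a four-dimensional real Lie algebra with center $\mathfrak C(\mathfrak g)$. A three-dimensional subspace $\mathfrak q\subset\mathfrak g$ is called generating if it generates $\mathfrak g$ by the Lie bracket. A basis $(e_1,e_2,e_3)$ of $\mathfrak q$ is called adapted if $(e_1,e_2,e_3,e_4:=[e_1,e_3])$ is a basis of $\mathfrak g$ and $C_{12}^4=C_{23}^4=0$, where $[e_i,e_j]=\sum_k C_{ij}^k e_k$. "$\mathfrak q$ has a basis $(e_1,e_2,e_3=[e_1,e_2])$ such that ..." means that $\mathfrak q$ has an adapted basis with $e_3=[e_1,e_2]$ and the stated property. "The following cases are possible" means that every three-dimensional generating subspace $\mathfrak q$ is in exactly one of the listed cases and that each listed case occurs for some three-dimensional generating subspace. The algebras are given in a basis $(E_1,E_2,E_3,E_4)$ by their nonzero commutators: - $2\mathfrak g_{2,1}$: $[E_1,E_2]=E_1$, $[E_3,E_4]=E_3$; - $\mathfrak g_{3,2}\oplus\mathfrak g_1$: $[E_2,E_3]=E_1-E_2$, $[E_3,E_1]=E_1$; - $\mathfrak g_{3,4}^\alpha\oplus\mathfrak g_1$: $[E_2,E_3]=E_1-\alpha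 E_2$, $[E_3,E_1]=\alpha E_1-E_2$; - $\mathfrak g_{3,5}^\alpha\oplus\mathfrak g_1$: $[E_2,E_3]=E_1-\alpha E_2$, $[E_3,E_1]=\alpha E_1+E_2$; - $\mathfrak g_{3,6}\oplus\mathfrak g_1$: $[E_2,E_3]=E_1$, $[E_3,E_1]=E_2$, $[E_1,E_2]=-E_3$; - $\mathfrak g_{3,7}\oplus\mathfrak g_1$: $[E_2,E_3]=E_1$, $[E_3,E_1]=E_2$, $[E_1,E_2]=E_3$; - $\mathfrak g_{4,1}$: $[E_2,E_4]=E_1$, $[E_3,E_4]=E_2$; - $\mathfrak g_{4,2}^\alpha$: $[E_1,E_4]=\alpha E_1$, $[E_2,E_4]=E_2$, $[E_3,E_4]=E_2+E_3$; - $\mathfrak g_{4,3}$: $[E_1,E_4]=E_1$, $[E_3,E_4]=E_2$; - $\mathfrak g_{4,4}$: $[E_1,E_4]=E_1$, $[E_2,E_4]=E_1+E_2$, $[E_3,E_4]=E_2+E_3$; - $\mathfrak g_{4,5}^{\alpha,\beta}$: $[E_1,E_4]=E_1$, $[E_2,E_4]=\beta E_2$, $[E_3,E_4]=\alpha E_3$;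 - $\mathfrak g_{4,6}^{\alpha,\beta}$: $[E_1,E_4]=\alpha E_1$, $[E_2,E_4]=\beta E_2-E_3$, $[E_3,E_4]=E_2+\beta E_3$; - $\mathfrak g_{4,7}$: $[E_1,E_4]=2E_1$, $[E_2,E_4]=E_2$, $[E_3,E_4]=E_2+E_3$, $[E_2,E_3]=E_1$; - $\mathfrak g_{4,8}^\alpha$: $[E_1,E_4]=(1+\alpha)E_1$, $[E_2,E_4]=E_2$, $[E_3,E_4]=\alpha E_3$, $[E_2,E_3]=E_1$; - $\mathfrak g_{4,9}^\alpha$: $[E_1,E_4]=2\alpha E_1$, $[E_2,E_4]=\alpha E_2-E_3$, $[E_3,E_4]=E_2+\alpha E_3$, $[E_2,E_3]=E_1$. Theorem 4. 1. If $\mathfrak g=2\mathfrak g_{2,1}$, the following two cases are possible: 1) $\mathfrak q$ contains a one-dimensional ideal of $\mathfrak g$; 2) $\mathfrak q$ has a basis $(e_1,e_2,e_3=[e_1,e_2])$ such that $0\ne[e_2,e_3]\parallel e_3$. The same holds with 2) replaced by: $\mathfrak q$ has an adapted basis $(e_1,e_2,e_3)$ such that $[e_1,e_2]=0$ and $0\neq[e_2,e_3]\parallel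 e_3$. 2. If $\mathfrak g$ is one of $\mathfrak g_{3,2}\oplus\mathfrak g_1$, $\mathfrak g_{3,4}^\alpha\oplus\mathfrak g_1$ ($0\le\alpha\ne1$), $\mathfrak g_{4,3}$, the following three cases are possible: 1) $\mathfrak C(\mathfrak g)\subset\mathfrak q$; 2) $\mathfrak q$ contains a one-dimensional noncentral ideal of $\mathfrak g$; 3) $\mathfrak q$ has a basis $(e_1,e_2,e_3=[e_1,e_2])$ such that $[e_2,e_3]=0$. 3. If $\mathfrak g$ is one of $\mathfrak g_{3,5}^\alpha\oplus\mathfrak g_1$ ($\alpha\ge0$), $\mathfrak g_{4,1}$, the following two cases are possible: 1) $\mathfrak C(\mathfrak g)\subset\mathfrak q$; 2) $\mathfrak q$ has a basis $(e_1,e_2,e_3=[e_1,e_2])$ such that $[e_2,e_3]=0$. 4. If $\mathfrak g=\mathfrak g_{3,6}\oplus\mathfrak g_1$, the following three cases are possible: 1) $\mathfrak g_1=\langle E_4\rangle\subset\mathfrak q$; 2) $\mathfrak q$ has a basis $(e_1,e_2,e_3=[e_1,e_2])$ such that $0\ne[e_2,e_3]\parallel e_2$; 3) $\mathfrak q$ has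 a basis $(e_1,e_2,e_3=[e_1,e_2])$ such that $0\neq[e_2,e_3]\parallel e_1$. 5. If $\mathfrak g=\mathfrak g_{3,7}\oplus\mathfrak g_1$, the following two cases are possible: 1) $\mathfrak C(\mathfrak g)\subset\mathfrak q$; 2) $\mathfrak q$ has a basis $(e_1,e_2,e_3=[e_1,e_2])$ such that $0\ne[e_2,e_3]\parallel e_1$. 6. If $\mathfrak g$ is one of $\mathfrak g_{4,2}^\alpha$ ($\alpha\notin\{0,1\}$), $\mathfrak g_{4,4}$, $\mathfrak g_{4,5}^{\alpha,\beta}$ ($-1<\alpha<\beta<1$, $\alpha\beta\ne0$, or $\alpha=-1$, $0<\beta<1$), $\mathfrak g_{4,6}^{\alpha,\beta}$ ($\alpha>0$, $\beta\in\mathbb R$), the following two cases are possible: 1) $\mathfrak q$ contains a one-dimensional noncentral ideal of $\mathfrak g$; 2) $\mathfrak q$ has a basis $(e_1,e_2,e_3=[e_1,e_2])$ such that $[e_2,e_3]=0$. If $\mathfrak g=\mathfrak g_{4,5}^{-1,1}$, then three-dimensional generating subspaces exist, and every such $\mathfrak q$ is in case 1) and not in case 2). 7. If $\mathfrak g$ is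 one of $\mathfrak g_{4,7}$, $\mathfrak g_{4,8}^\alpha$ ($-1<\alpha<1$, $\alpha\ne0$), $\mathfrak g_{4,9}^\alpha$ ($\alpha>0$), the following two cases are possible: 1) $\mathfrak q$ contains a one-dimensional noncentral ideal of $\mathfrak g$; 2) $\mathfrak q$ has a basis $(e_1,e_2,e_3=[e_1,e_2])$ such that $C_{23}^1\ne0$, $C_{23}^2=0$. 8. If $\mathfrak g=\mathfrak g_{4,8}^{-1}$ or $\mathfrak g=\mathfrak g_{4,9}^0$, the following two cases are possible: 1) $\mathfrak C(\mathfrak g)\subset\mathfrak q$; 2) $\mathfrak q$ has a basis $(e_1,e_2,e_3=[e_1,e_2])$ such that $C_{23}^1\neq0$, $C_{23}^2=0$. 9. If $\mathfrak g=\mathfrak g_{4,8}^0$, the following two cases are possible: 1) $\mathfrak q$ contains a one-dimensional noncentral ideal of $\mathfrak g$; 2) $\mathfrak q$ has a basis $(e_1,e_2,e_3=[e_1,e_2])$ such that $C_{23}^1=C_{23}^2=0$. -/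

import Mathlib

namespace FourDimLie

open Module

variable {g : Type*} [LieRing g] [LieAlgebra ℝ g]

/-! The basis written `E₁, E₂, E₃, E₄` in the literature is `E 0, E 1, E 2, E 3` here (and likewise
`e₁, …, e₄` is `e 0, …, e 3`). -/

/-- `vij` is the commutator of the `i`-th and the `j`-th vector of the basis `E` (counted from 1);
the other commutators follow by antisymmetry. -/
def HasBrackets (E : Basis (Fin 4) ℝ g) (v12 v13 v14 v23 v24 v34 : g) : Prop :=
  ⁅E 0, E 1⁆ = v12 ∧ ⁅E 0, E 2⁆ = v13 ∧ ⁅E 0, E 3⁆ = v14 ∧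
  ⁅E 1, E 2⁆ = v23 ∧ ⁅E 1, E 3⁆ = v24 ∧ ⁅E 2, E 3⁆ = v34

/-! ### The four-dimensional real Lie algebras, each given by a basis and its commutators -/

/-- `2 g_{2,1}`: `[E₁,E₂] = E₁`, `[E₃,E₄] = E₃`. -/
def TwoG21 (E : Basis (Fin 4) ℝ g) : Prop :=
  HasBrackets E (E 0) 0 0 0 0 (E 2)

/-- `g_{3,2} ⊕ g_1`: `[E₂,E₃] = E₁ - E₂`, `[E₃,E₁] = E₁`. -/
def G32G1 (E : Basis (Fin 4) ℝ g) : Prop :=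
  HasBrackets E 0 (-E 0) 0 (E 0 - E 1) 0 0

/-- `g_{3,4}^α ⊕ g_1`: `[E₂,E₃] = E₁ - αE₂`, `[E₃,E₁] = αE₁ - E₂`. -/
def G34G1 (α : ℝ) (E : Basis (Fin 4) ℝ g) : Prop :=
  HasBrackets E 0 (-(α • E 0 - E 1)) 0 (E 0 - α • E 1) 0 0

/-- `g_{3,5}^α ⊕ g_1`: `[E₂,E₃] = E₁ - αE₂`, `[E₃,E₁] = αE₁ + E₂`. -/
def G35G1 (α : ℝ) (E : Basis (Fin 4) ℝ g) : Prop :=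
  HasBrackets E 0 (-(α • E 0 + E 1)) 0 (E 0 - α • E 1) 0 0

/-- `g_{3,6} ⊕ g_1`: `[E₂,E₃] = E₁`, `[E₃,E₁] = E₂`, `[E₁,E₂] = -E₃`. -/
def G36G1 (E : Basis (Fin 4) ℝ g) : Prop :=
  HasBrackets E (-E 2) (-E 1) 0 (E 0) 0 0

/-- `g_{3,7} ⊕ g_1`: `[E₂,E₃] = E₁`, `[E₃,E₁] = E₂`, `[E₁,E₂] = E₃`. -/
def G37G1 (E : Basis (Fin 4) ℝ g) : Prop :=
  HasBrackets E (E 2) (-E 1) 0 (E 0) 0 0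

/-- `g_{4,1}`: `[E₂,E₄] = E₁`, `[E₃,E₄] = E₂`. -/
def G41 (E : Basis (Fin 4) ℝ g) : Prop :=
  HasBrackets E 0 0 0 0 (E 0) (E 1)

/-- `g_{4,2}^α`: `[E₁,E₄] = αE₁`, `[E₂,E₄] = E₂`, `[E₃,E₄] = E₂ + E₃`. -/
def G42 (α : ℝ) (E : Basis (Fin 4) ℝ g) : Prop :=
  HasBrackets E 0 0 (α • E 0) 0 (E 1) (E 1 + E 2)

/-- `g_{4,3}`: `[E₁,E₄] = E₁`, `[E₃,E₄] = E₂`. -/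
def G43 (E : Basis (Fin 4) ℝ g) : Prop :=
  HasBrackets E 0 0 (E 0) 0 0 (E 1)

/-- `g_{4,4}`: `[E₁,E₄] = E₁`, `[E₂,E₄] = E₁ + E₂`, `[E₃,E₄] = E₂ + E₃`. -/
def G44 (E : Basis (Fin 4) ℝ g) : Prop :=
  HasBrackets E 0 0 (E 0) 0 (E 0 + E 1) (E 1 + E 2)

/-- `g_{4,5}^{α,β}`: `[E₁,E₄] = E₁`, `[E₂,E₄] = βE₂`, `[E₃,E₄] = αE₃`. -/
def G45 (α β : ℝ) (E : Basis (Fin 4) ℝ g) : Prop :=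
  HasBrackets E 0 0 (E 0) 0 (β • E 1) (α • E 2)

/-- `g_{4,6}^{α,β}`: `[E₁,E₄] = αE₁`, `[E₂,E₄] = βE₂ - E₃`, `[E₃,E₄] = E₂ + βE₃`. -/
def G46 (α β : ℝ) (E : Basis (Fin 4) ℝ g) : Prop :=
  HasBrackets E 0 0 (α • E 0) 0 (β • E 1 - E 2) (E 1 + β • E 2)

/-- `g_{4,7}`: `[E₁,E₄] = 2E₁`, `[E₂,E₄] = E₂`, `[E₃,E₄] = E₂ + E₃`, `[E₂,E₃] = E₁`. -/
def G47 (E : Basis (Fin 4) ℝ g) : Prop :=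
  HasBrackets E 0 0 ((2 : ℝ) • E 0) (E 0) (E 1) (E 1 + E 2)

/-- `g_{4,8}^α`: `[E₁,E₄] = (1+α)E₁`, `[E₂,E₄] = E₂`, `[E₃,E₄] = αE₃`, `[E₂,E₃] = E₁`. -/
def G48 (α : ℝ) (E : Basis (Fin 4) ℝ g) : Prop :=
  HasBrackets E 0 0 ((1 + α) • E 0) (E 0) (E 1) (α • E 2)

/-- `g_{4,9}^α`: `[E₁,E₄] = 2αE₁`, `[E₂,E₄] = αE₂ - E₃`, `[E₃,E₄] = E₂ + αE₃`, `[E₂,E₃] = E₁`. -/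
def G49 (α : ℝ) (E : Basis (Fin 4) ℝ g) : Prop :=
  HasBrackets E 0 0 ((2 * α) • E 0) (E 0) (α • E 1 - E 2) (E 1 + α • E 2)

/-! ### Generating subspaces and the properties that distinguish them -/

/-- `q` is a three-dimensional subspace which generates `g` by the Lie bracket. -/
def IsGenerating (q : Submodule ℝ g) : Prop :=
  finrank ℝ q = 3 ∧ LieSubalgebra.lieSpan ℝ g (q : Set g) = ⊤

/-- `q` contains the center of `g`. -/
def ContainsCenter (q : Submodule ℝ g) : Prop :=
  (LieAlgebra.center ℝ g).toSubmodule ≤ q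

/-- `q` contains a one-dimensional ideal of `g`. -/
def ContainsIdeal (q : Submodule ℝ g) : Prop :=
  ∃ I : LieIdeal ℝ g, finrank ℝ I = 1 ∧ I.toSubmodule ≤ q

/-- `q` contains a one-dimensional ideal of `g` which is not central. -/
def ContainsNoncentralIdeal (q : Submodule ℝ g) : Prop :=
  ∃ I : LieIdeal ℝ g, finrank ℝ I = 1 ∧ ¬ I ≤ LieAlgebra.center ℝ g ∧ I.toSubmodule ≤ q

/-- The structure constant `C_{ij}^k` of `g` in the basis `e`. -/
noncomputable def structConst (e : Basis (Fin 4) ℝ g) (i j k : Fin 4) : ℝ :=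
  e.repr ⁅e i, e j⁆ k

/-- `(e₁, e₂, e₃)` is an adapted basis of `q`: it is a basis of `q`, it is completed to the basis
`e` of `g` by `e₄ = [e₁, e₃]`, and `C_{12}^4 = C_{23}^4 = 0`. -/
structure IsAdapted (q : Submodule ℝ g) (e : Basis (Fin 4) ℝ g) : Prop where
  span_eq : Submodule.span ℝ {e 0, e 1, e 2} = q
  fourth : e 3 = ⁅e 0, e 2⁆
  c124 : structConst e 0 1 3 = 0
  c234 : structConst e 1 2 3 = 0

/-- `q` has an adapted basis `(e₁, e₂, e₃ = [e₁, e₂])` with the property `P`. -/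
def HasBasisWith (P : Basis (Fin 4) ℝ g → Prop) (q : Submodule ℝ g) : Prop :=
  ∃ e : Basis (Fin 4) ℝ g, IsAdapted q e ∧ e 2 = ⁅e 0, e 1⁆ ∧ P e

/-- `q` has an adapted basis `(e₁, e₂, e₃)` with `[e₁, e₂] = 0` and the property `P`. -/
def HasCommutingBasisWith (P : Basis (Fin 4) ℝ g → Prop) (q : Submodule ℝ g) : Prop :=
  ∃ e : Basis (Fin 4) ℝ g, IsAdapted q e ∧ ⁅e 0, e 1⁆ = 0 ∧ P e

/-- `[e₂, e₃]` is nonzero and parallel to the basis vector `e i`. -/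
def NonzeroParallel (i : Fin 4) (e : Basis (Fin 4) ℝ g) : Prop :=
  ∃ c : ℝ, c ≠ 0 ∧ ⁅e 1, e 2⁆ = c • e i

/-- The cases `P 0, P 1, …` are exactly the possible ones for three-dimensional generating
subspaces: every such subspace is in exactly one of the cases, and each case occurs. -/
def PossibleCases {n : ℕ} (P : Fin n → Submodule ℝ g → Prop) : Prop :=
  (∀ q : Submodule ℝ g, IsGenerating q → ∃! i, P i q) ∧
  ∀ i, ∃ q : Submodule ℝ g, IsGenerating q ∧ P i q

end FourDimLie

open FourDimLie

/-!
A three-dimensional subspace `q` that is not a subalgebra carries the nonzero alternating form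
`q × q → g / q` induced by the bracket. Its kernel is a line `L ⊂ q`, and a basis of `q` is adapted
exactly when its second vector spans `L` (`IsAdapted.eq_smul_second`, `exists_isAdapted`). Since
`ad e₂` maps `q` to itself, the cases of the theorem are statements about the operator induced by
`ad e₂` on `q`.

*The cases exclude each other.* A one-dimensional ideal inside `q`, central or not, lies in the
kernel of the form, hence equals `L`. Then `[e₁, e₂] ∥ e₂`, so that `e₃ = [e₁, e₂]` is impossible
(`not_hasBasisWith`), and `q` cannot contain both the center and a noncentral ideal
(`not_containsNoncentralIdeal`). The two noncentral cases of `g_{3,6} ⊕ g_1` differ in whether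
`ad e₂` is nilpotent on `q` (`not_hasBasisWith_parallel_first`).

*The cases exhaust all `q`, and each occurs.* The algebras fall into four families.

* `ℝ T` acting by `A = ad T` on an abelian ideal of dimension three. The line `L` lies in the
  ideal. Either it is an eigenline of `A`, hence an ideal of `g`, central or not according to the
  eigenvalue, or `(T', v, A v)` with `v ∈ L` is the desired basis
  (`IsAbelianExtension.eigenvector_or_hasBasisWith`). The ideal cases occur if `A` is not scalar
  modulo an eigenline, the remaining one if `A` has a cyclic vector; for `g_{4,5}^{-1,1}` one has
  `A² = 1`, and there is none.
* Extensions of `ℝ` by the Heisenberg algebra `⟨E₁, E₂, E₃⟩`. If `E₁ ∉ q`, then `-ad e₂` acts on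
  `q / L` by the same matrix as `-ad E₄` on `⟨E₂, E₃⟩` modulo `E₁`; its determinant is `C_{23}^1`
  (`IsHeisenbergExtension.hasBasisWith`).
* `2 g_{2,1}`. If `q` contains neither of the ideals `ℝ E₁`, `ℝ E₃`, it is unique up to an
  automorphism (`TwoG21.exists_triple`).
* `g_{3,6} ⊕ g_1` and `g_{3,7} ⊕ g_1`. If `E₄ ∉ q`, then `q` is the graph of a nonzero functional
  on the simple factor, and `ad e₂` acts on `q` as the adjoint action of the vector dual to this
  functional (`IsSimpleSum.hasBasisWith`).
-/

namespace FourDimLie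

open Module

variable {g : Type*} [LieRing g] [LieAlgebra ℝ g]

/-! ### Hyperplanes, generation and adapted bases -/

theorem exists_add_smul_mem (E : Basis (Fin 4) ℝ g) {q : Submodule ℝ g} (hq : finrank ℝ q = 3)
    {x : g} (hx : x ∉ q) (y : g) : ∃ c : ℝ, y + c • x ∈ q := by
  have : Module.Finite ℝ g := Module.Finite.of_basis E
  have h4 : finrank ℝ g = 4 := by simp [finrank_eq_card_basis E]
  have hlt : q < q ⊔ Submodule.span ℝ {x} := by
    refine lt_of_le_of_ne le_sup_left fun h => hx ?_
    rw [h]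
    exact Submodule.mem_sup_right (Submodule.mem_span_singleton_self x)
  have htop : q ⊔ Submodule.span ℝ {x} = ⊤ := by
    apply Submodule.eq_top_of_finrank_eq
    have h1 := Submodule.finrank_lt_finrank_of_lt hlt
    have h2 := Submodule.finrank_le (q ⊔ Submodule.span ℝ {x})
    omega
  obtain ⟨z, hz, w, hw, hzw⟩ := Submodule.mem_sup.1 (htop ▸ Submodule.mem_top : y ∈ q ⊔ _)
  obtain ⟨c, rfl⟩ := Submodule.mem_span_singleton.1 hw
  exact ⟨-c, by rw [← hzw]; simpa using hz⟩

/-- A generating hyperplane is not a subalgebra. -/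
theorem IsGenerating.not_forall_lie_mem (E : Basis (Fin 4) ℝ g) {q : Submodule ℝ g}
    (hq : IsGenerating q) : ¬ ∀ x ∈ q, ∀ y ∈ q, ⁅x, y⁆ ∈ q := by
  intro h
  let K : LieSubalgebra ℝ g := { q with lie_mem' := fun {x y} hx hy => h x hx y hy }
  have hK : (⊤ : LieSubalgebra ℝ g) ≤ K := by
    rw [← hq.2]
    exact LieSubalgebra.lieSpan_le.2 fun x hx => hx
  have hqt : q = ⊤ := by
    rw [eq_top_iff]
    exact fun x _ => hK (LieSubalgebra.mem_top x)
  have h3 := hq.1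
  rw [hqt, finrank_top, finrank_eq_card_basis E] at h3
  simp at h3

theorem lie_comb_three (a b c a' b' c' : ℝ) (u v w : g) :
    ⁅a • u + b • v + c • w, a' • u + b' • v + c' • w⁆ =
      (a * b' - b * a') • ⁅u, v⁆ + (a * c' - c * a') • ⁅u, w⁆ + (b * c' - c * b') • ⁅v, w⁆ := by
  have h1 : ⁅v, u⁆ = -⁅u, v⁆ := (lie_skew v u).symm
  have h2 : ⁅w, u⁆ = -⁅u, w⁆ := (lie_skew w u).symm
  have h3 : ⁅w, v⁆ = -⁅v, w⁆ := (lie_skew w v).symm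
  simp only [lie_add, add_lie, smul_lie, lie_smul, lie_self, h1, h2, h3]
  module

/-- A hyperplane that contains two vectors but not their bracket generates the Lie algebra. -/
theorem isGenerating_of_lie_notMem (E : Basis (Fin 4) ℝ g) {q : Submodule ℝ g}
    (hq : finrank ℝ q = 3) {x y : g} (hx : x ∈ q) (hy : y ∈ q) (hxy : ⁅x, y⁆ ∉ q) :
    IsGenerating q := by
  refine ⟨hq, eq_top_iff.2 fun z _ => ?_⟩
  obtain ⟨c, hc⟩ := exists_add_smul_mem E hq hxy z
  have hsub : ∀ w ∈ q, w ∈ LieSubalgebra.lieSpan ℝ g (q : Set g) :=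
    fun w hw => LieSubalgebra.subset_lieSpan hw
  have := sub_mem (hsub _ hc)
    (SMulMemClass.smul_mem c (LieSubalgebra.lie_mem _ (hsub x hx) (hsub y hy)))
  simpa using this

theorem linearIndependent_three {u v w : g}
    (h : ∀ a b c : ℝ, a • u + b • v + c • w = 0 → a = 0 ∧ b = 0 ∧ c = 0) :
    LinearIndependent ℝ ![u, v, w] := by
  rw [Fintype.linearIndependent_iff]
  intro f hf
  obtain ⟨h0, h1, h2⟩ := h (f 0) (f 1) (f 2) (by simpa [Fin.sum_univ_three] using hf)
  intro i
  fin_cases i <;> assumption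

theorem linearIndependent_four {u v w z : g}
    (h : ∀ a b c d : ℝ, a • u + b • v + c • w + d • z = 0 → a = 0 ∧ b = 0 ∧ c = 0 ∧ d = 0) :
    LinearIndependent ℝ ![u, v, w, z] := by
  rw [Fintype.linearIndependent_iff]
  intro f hf
  obtain ⟨h0, h1, h2, h3⟩ := h (f 0) (f 1) (f 2) (f 3) (by simpa [Fin.sum_univ_four] using hf)
  intro i
  fin_cases i <;> assumption

theorem finrank_span_three {u v w : g} (h : LinearIndependent ℝ ![u, v, w]) :
    finrank ℝ (Submodule.span ℝ {u, v, w}) = 3 := by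
  have := finrank_span_eq_card h
  have hr : Set.range ![u, v, w] = {u, v, w} := by
    simp [Matrix.range_cons, Set.insert_def, Set.union_def]
  rw [hr] at this
  simpa using this

theorem eq_zero_of_linearIndependent_four {u v w z : g} (h : LinearIndependent ℝ ![u, v, w, z])
    {a b c d : ℝ} (h0 : a • u + b • v + c • w + d • z = 0) :
    a = 0 ∧ b = 0 ∧ c = 0 ∧ d = 0 := by
  have := Fintype.linearIndependent_iff.1 h ![a, b, c, d] (by simpa [Fin.sum_univ_four] using h0)
  exact ⟨this 0, this 1, this 2, this 3⟩

theorem isGenerating_span (E : Basis (Fin 4) ℝ g) {u v w : g}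
    (h : LinearIndependent ℝ ![u, v, w, ⁅u, w⁆]) :
    IsGenerating (Submodule.span ℝ {u, v, w}) := by
  have h3 : LinearIndependent ℝ ![u, v, w] := linearIndependent_three fun a b c h0 => by
    obtain ⟨ha, hb, hc, -⟩ := eq_zero_of_linearIndependent_four h
      (show a • u + b • v + c • w + (0 : ℝ) • ⁅u, w⁆ = 0 by simpa using h0)
    exact ⟨ha, hb, hc⟩
  refine isGenerating_of_lie_notMem E (x := u) (y := w) (finrank_span_three h3)
    (Submodule.subset_span (by simp)) (Submodule.subset_span (by simp)) ?_
  rw [Submodule.mem_span_triple]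
  rintro ⟨a, b, c, habc⟩
  have := (eq_zero_of_linearIndependent_four h
    (show a • u + b • v + c • w + (-1 : ℝ) • ⁅u, w⁆ = 0 by
      rw [habc, neg_one_smul, add_neg_cancel])).2.2.2
  norm_num at this

theorem Basis.repr_three_eq_zero (e : Basis (Fin 4) ℝ g) {x : g}
    (hx : x ∈ Submodule.span ℝ {e 0, e 1, e 2}) : e.repr x 3 = 0 := by
  obtain ⟨a, b, c, rfl⟩ := Submodule.mem_span_triple.1 hx
  simp

/-- Three independent vectors `u`, `v`, `w` of a generating hyperplane `q` with `[u, v]` and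
`[v, w]` in `q` form an adapted basis: `[u, w]` is outside `q`, as `q` is not a subalgebra. -/
theorem exists_isAdapted (E : Basis (Fin 4) ℝ g) {q : Submodule ℝ g} (hq : IsGenerating q)
    {u v w : g} (hu : u ∈ q) (hv : v ∈ q) (hw : w ∈ q)
    (hli : ∀ a b c : ℝ, a • u + b • v + c • w = 0 → a = 0 ∧ b = 0 ∧ c = 0)
    (huv : ⁅u, v⁆ ∈ q) (hvw : ⁅v, w⁆ ∈ q) :
    ∃ e : Basis (Fin 4) ℝ g, IsAdapted q e ∧ e 0 = u ∧ e 1 = v ∧ e 2 = w := by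
  have : Module.Finite ℝ g := Module.Finite.of_basis E
  have hspan : Submodule.span ℝ {u, v, w} = q := by
    apply Submodule.eq_of_le_of_finrank_eq
    · rw [Submodule.span_le]
      rintro x (rfl | rfl | rfl) <;> assumption
    · rw [finrank_span_three (linearIndependent_three hli), hq.1]
  have hn : ⁅u, w⁆ ∉ q := by
    intro huw
    refine hq.not_forall_lie_mem E fun x hx y hy => ?_
    rw [← hspan] at hx hy
    obtain ⟨a, b, c, rfl⟩ := Submodule.mem_span_triple.1 hx
    obtain ⟨a', b', c', rfl⟩ := Submodule.mem_span_triple.1 hy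
    rw [lie_comb_three]
    exact add_mem (add_mem (q.smul_mem _ huv) (q.smul_mem _ huw)) (q.smul_mem _ hvw)
  have h4 : LinearIndependent ℝ ![u, v, w, ⁅u, w⁆] := linearIndependent_four fun a b c d h => by
    have hd : d = 0 := by
      by_contra hd
      refine hn ((Submodule.smul_mem_iff q hd).1 ?_)
      rw [← neg_eq_of_add_eq_zero_right h]
      exact neg_mem (add_mem (add_mem (q.smul_mem _ hu) (q.smul_mem _ hv)) (q.smul_mem _ hw))
    subst hd
    obtain ⟨ha, hb, hc⟩ := hli a b c (by simpa using h)
    exact ⟨ha, hb, hc, rfl⟩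
  let e := basisOfLinearIndependentOfCardEqFinrank h4 (by simp [finrank_eq_card_basis E])
  have he : ⇑e = ![u, v, w, ⁅u, w⁆] := coe_basisOfLinearIndependentOfCardEqFinrank h4 _
  have h0 : e 0 = u := by simp [he]
  have h1 : e 1 = v := by simp [he]
  have h2 : e 2 = w := by simp [he]
  have hs : Submodule.span ℝ {e 0, e 1, e 2} = q := by rw [h0, h1, h2, hspan]
  refine ⟨e, ⟨hs, ?_, ?_, ?_⟩, h0, h1, h2⟩
  · rw [h0, h2]; simp [he]
  · exact Basis.repr_three_eq_zero e (by rw [hs, h0, h1]; exact huv)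
  · exact Basis.repr_three_eq_zero e (by rw [hs, h1, h2]; exact hvw)

/-! ### One-dimensional ideals -/

/-- The second vector of an adapted basis spans the kernel of the alternating form
`q × q → g / q` induced by the bracket. -/
theorem IsAdapted.eq_smul_second {q : Submodule ℝ g} {e : Basis (Fin 4) ℝ g}
    (he : IsAdapted q e) {v : g} (hv : v ≠ 0) (hvq : v ∈ q) (hL : ∀ x ∈ q, ⁅x, v⁆ ∈ q) :
    ∃ b : ℝ, b ≠ 0 ∧ v = b • e 1 := by
  have hvs := hvq
  rw [← he.span_eq] at hvs
  obtain ⟨a, b, c, habc⟩ := Submodule.mem_span_triple.1 hvs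
  have key : ∀ x ∈ q, e.repr ⁅x, v⁆ 3 = 0 := fun x hx =>
    Basis.repr_three_eq_zero e (by rw [he.span_eq]; exact hL x hx)
  have h12 : e.repr ⁅e 0, e 1⁆ 3 = 0 := he.c124
  have h23 : e.repr ⁅e 1, e 2⁆ 3 = 0 := he.c234
  have hc : c = 0 := by
    have := key (e 0) (by rw [← he.span_eq]; exact Submodule.subset_span (by simp))
    rw [← habc] at this
    simpa [h12, ← he.fourth] using this
  have ha : a = 0 := by
    have := key (e 2) (by rw [← he.span_eq]; exact Submodule.subset_span (by simp))
    rw [← habc] at this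
    have h20 : ⁅e 2, e 0⁆ = -e 3 := by rw [he.fourth, lie_skew]
    have h21 : ⁅e 2, e 1⁆ = -⁅e 1, e 2⁆ := (lie_skew _ _).symm
    simpa [h20, h21, h23, -lie_skew] using this
  subst hc ha
  simp only [zero_smul, zero_add, add_zero] at habc
  refine ⟨b, ?_, habc.symm⟩
  rintro rfl
  exact hv (by simp [← habc])

/-- If `v` spans an ideal inside `q`, then bracketing with the second vector of an adapted basis
produces only multiples of that vector. -/
theorem IsAdapted.lie_second {q : Submodule ℝ g} {e : Basis (Fin 4) ℝ g}
    (he : IsAdapted q e) {v : g} (hv : v ≠ 0) (hvq : v ∈ q)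
    (hid : ∀ x : g, ∃ c : ℝ, ⁅x, v⁆ = c • v) (x : g) : ∃ c : ℝ, ⁅x, e 1⁆ = c • e 1 := by
  obtain ⟨b, hb, rfl⟩ := he.eq_smul_second hv hvq fun x _ => by
    obtain ⟨c, hc⟩ := hid x
    rw [hc]
    exact q.smul_mem c hvq
  obtain ⟨c, hc⟩ := hid x
  refine ⟨c, ?_⟩
  rw [lie_smul, smul_comm] at hc
  exact smul_right_injective g hb hc

theorem not_hasBasisWith {q : Submodule ℝ g} {v : g} (hv : v ≠ 0) (hvq : v ∈ q)
    (hid : ∀ x : g, ∃ c : ℝ, ⁅x, v⁆ = c • v) (P : Basis (Fin 4) ℝ g → Prop) :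
    ¬ HasBasisWith P q := by
  rintro ⟨e, he, h2, -⟩
  obtain ⟨c, hc⟩ := he.lie_second hv hvq hid (e 0)
  have := congrArg (fun x => e.repr x 2) (h2.trans hc)
  simp at this

theorem not_hasCommutingBasisWith {q : Submodule ℝ g} {v : g} (hv : v ≠ 0) (hvq : v ∈ q)
    (hid : ∀ x : g, ∃ c : ℝ, ⁅x, v⁆ = c • v) :
    ¬ HasCommutingBasisWith (NonzeroParallel 2) q := by
  rintro ⟨e, he, -, d, hd, h12⟩
  obtain ⟨c, hc⟩ := he.lie_second hv hvq hid (e 2)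
  rw [← lie_skew, h12] at hc
  have := congrArg (fun x => e.repr x 2) hc
  simp [hd] at this

theorem exists_generator_of_finrank_one (I : LieIdeal ℝ g) (hI : finrank ℝ I = 1) :
    ∃ v : g, v ≠ 0 ∧ v ∈ I ∧ ∀ x ∈ I, ∃ c : ℝ, x = c • v := by
  obtain ⟨⟨v, hvI⟩, hv, h⟩ := finrank_eq_one_iff'.1 hI
  refine ⟨v, fun h0 => hv (Subtype.ext h0), hvI, fun x hx => ?_⟩
  obtain ⟨c, hc⟩ := h ⟨x, hx⟩
  exact ⟨c, (congrArg Subtype.val hc).symm⟩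

theorem ContainsIdeal.exists_vector {q : Submodule ℝ g} (h : ContainsIdeal q) :
    ∃ v : g, v ≠ 0 ∧ v ∈ q ∧ ∀ x : g, ∃ c : ℝ, ⁅x, v⁆ = c • v := by
  obtain ⟨I, hI, hIq⟩ := h
  obtain ⟨v, hv, hvI, hc⟩ := exists_generator_of_finrank_one I hI
  exact ⟨v, hv, hIq hvI, fun x => hc _ (lie_mem_right ℝ g I x v hvI)⟩

theorem ContainsNoncentralIdeal.containsIdeal {q : Submodule ℝ g}
    (h : ContainsNoncentralIdeal q) : ContainsIdeal q := by
  obtain ⟨I, hI, -, hIq⟩ := h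
  exact ⟨I, hI, hIq⟩

theorem mem_center_iff {z : g} : z ∈ LieAlgebra.center ℝ g ↔ ∀ x : g, ⁅x, z⁆ = 0 :=
  LieModule.mem_maxTrivSubmodule ℝ g g z

theorem exists_ideal_of_vector {v : g} (hv : v ≠ 0) (hid : ∀ x : g, ∃ c : ℝ, ⁅x, v⁆ = c • v) :
    ∃ I : LieIdeal ℝ g, finrank ℝ I = 1 ∧ I.toSubmodule = Submodule.span ℝ {v} := by
  let I : LieIdeal ℝ g :=
    { Submodule.span ℝ {v} with
      lie_mem := by
        intro x m hm
        obtain ⟨a, rfl⟩ := Submodule.mem_span_singleton.1 hm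
        obtain ⟨c, hc⟩ := hid x
        rw [lie_smul, hc]
        exact Submodule.smul_mem _ _
          (Submodule.smul_mem _ _ (Submodule.mem_span_singleton_self v)) }
  exact ⟨I, finrank_span_singleton hv, rfl⟩

theorem containsIdeal_of_vector {q : Submodule ℝ g} {v : g} (hv : v ≠ 0) (hvq : v ∈ q)
    (hid : ∀ x : g, ∃ c : ℝ, ⁅x, v⁆ = c • v) : ContainsIdeal q := by
  obtain ⟨I, hI, hIv⟩ := exists_ideal_of_vector hv hid
  exact ⟨I, hI, by rw [hIv, Submodule.span_singleton_le_iff_mem]; exact hvq⟩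

theorem containsNoncentralIdeal_of_vector {q : Submodule ℝ g} {v : g} (hvq : v ∈ q)
    (hid : ∀ x : g, ∃ c : ℝ, ⁅x, v⁆ = c • v) {y : g} (hy : ⁅y, v⁆ ≠ 0) :
    ContainsNoncentralIdeal q := by
  have hv : v ≠ 0 := by rintro rfl; simp at hy
  obtain ⟨I, hI, hIv⟩ := exists_ideal_of_vector hv hid
  have hvI : v ∈ I.toSubmodule := by rw [hIv]; exact Submodule.mem_span_singleton_self v
  refine ⟨I, hI, fun h => hy (mem_center_iff.1 (h hvI) y), ?_⟩
  rw [hIv, Submodule.span_singleton_le_iff_mem]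
  exact hvq

/-- A generating hyperplane cannot contain both a nonzero central vector `z` and a one-dimensional
noncentral ideal `ℝ v`: with any third vector `w` of `q`, the only nonzero bracket would be
`[v, w] ∈ ℝ v`, and `q` would be a subalgebra. -/
theorem not_containsNoncentralIdeal (E : Basis (Fin 4) ℝ g) {q : Submodule ℝ g}
    (hq : IsGenerating q) {z : g} (hz : z ≠ 0) (hzq : z ∈ q) (hzc : ∀ x : g, ⁅x, z⁆ = 0) :
    ¬ ContainsNoncentralIdeal q := by
  have : Module.Finite ℝ g := Module.Finite.of_basis E
  rintro ⟨I, hI, hIc, hIq⟩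
  obtain ⟨v, hv, hvI, hc⟩ := exists_generator_of_finrank_one I hI
  have hvq : v ∈ q := hIq hvI
  have hzv : ∀ c : ℝ, v ≠ c • z := fun c h => hIc fun x hx => mem_center_iff.2 fun y => by
    obtain ⟨d, rfl⟩ := hc x hx
    rw [h, lie_smul, lie_smul, hzc, smul_zero, smul_zero]
  obtain ⟨w, hwq, hw⟩ : ∃ w ∈ q, w ∉ Submodule.span ℝ {z, v} := by
    by_contra! h
    have h1 := Submodule.finrank_mono (show q ≤ Submodule.span ℝ {z, v} from h)
    have h2 := finrank_range_le_card (R := ℝ) ![z, v]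
    rw [Set.finrank, Matrix.range_cons, Matrix.range_cons, Matrix.range_empty, Set.union_empty,
      Set.singleton_union, Fintype.card_fin] at h2
    have := hq.1
    omega
  have hli : LinearIndependent ℝ ![z, v, w] := linearIndependent_three fun a b c h => by
    have hc0 : c = 0 := by
      by_contra hc0
      refine hw ((Submodule.smul_mem_iff _ hc0).1 ?_)
      rw [← neg_eq_of_add_eq_zero_right h]
      exact neg_mem (Submodule.mem_span_pair.2 ⟨a, b, rfl⟩)
    subst hc0
    have hb0 : b = 0 := by
      by_contra hb0
      refine hzv (-(b⁻¹ * a)) ?_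
      have h' : b • v = -(a • z) := by
        rw [zero_smul, add_zero] at h
        exact (neg_eq_of_add_eq_zero_right h).symm
      rw [neg_smul, mul_smul, ← smul_neg, ← h', inv_smul_smul₀ hb0]
    subst hb0
    exact ⟨by simpa [hz] using h, rfl, rfl⟩
  have hspan : Submodule.span ℝ {z, v, w} = q := by
    apply Submodule.eq_of_le_of_finrank_eq
    · rw [Submodule.span_le]
      rintro x (rfl | rfl | rfl) <;> assumption
    · rw [finrank_span_three hli, hq.1]
  refine hq.not_forall_lie_mem E fun x hx y hy => ?_
  rw [← hspan] at hx hy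
  obtain ⟨a, b, c, rfl⟩ := Submodule.mem_span_triple.1 hx
  obtain ⟨a', b', c', rfl⟩ := Submodule.mem_span_triple.1 hy
  have hz' : ∀ x : g, ⁅z, x⁆ = 0 := fun x => by rw [← lie_skew, hzc, neg_zero]
  rw [lie_comb_three, hz', hz', smul_zero, smul_zero, zero_add, zero_add]
  refine q.smul_mem _ ?_
  rw [← lie_skew]
  exact neg_mem (hIq (lie_mem_right ℝ g I w v hvI))

theorem containsCenter_of_mem {q : Submodule ℝ g} {z : g} (hzq : z ∈ q)
    (hz : ∀ x : g, (∀ y : g, ⁅y, x⁆ = 0) → ∃ c : ℝ, x = c • z) : ContainsCenter q := by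
  intro x hx
  obtain ⟨c, rfl⟩ := hz x (mem_center_iff.1 hx)
  exact q.smul_mem c hzq

theorem ContainsCenter.mem {q : Submodule ℝ g} (h : ContainsCenter q) {z : g}
    (hz : ∀ x : g, ⁅x, z⁆ = 0) : z ∈ q :=
  h (mem_center_iff.2 hz)

theorem not_hasBasisWith_of_containsIdeal {q : Submodule ℝ g} (h : ContainsIdeal q)
    (P : Basis (Fin 4) ℝ g → Prop) : ¬ HasBasisWith P q := by
  obtain ⟨v, hv, hvq, hid⟩ := h.exists_vector
  exact not_hasBasisWith hv hvq hid P

theorem not_hasBasisWith_of_containsCenter {q : Submodule ℝ g} (h : ContainsCenter q)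
    {z : g} (hz0 : z ≠ 0) (hz : ∀ x : g, ⁅x, z⁆ = 0) (P : Basis (Fin 4) ℝ g → Prop) :
    ¬ HasBasisWith P q :=
  not_hasBasisWith hz0 (h.mem hz) (fun x => ⟨0, by rw [hz, zero_smul]⟩) P

/-! ### Lists of cases -/

theorem possibleCases_two {P Q : Submodule ℝ g → Prop}
    (hor : ∀ q, IsGenerating q → P q ∨ Q q) (hPQ : ∀ q, P q → ¬ Q q)
    (hP : ∃ q, IsGenerating q ∧ P q) (hQ : ∃ q, IsGenerating q ∧ Q q) :
    PossibleCases ![P, Q] := by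
  refine ⟨fun q hq => ?_, fun i => by fin_cases i <;> assumption⟩
  have hPQ := hPQ q
  rcases hor q hq with h | h
  · refine ⟨0, h, fun i hi => ?_⟩
    fin_cases i
    · rfl
    · exact absurd hi (hPQ h)
  · refine ⟨1, h, fun i hi => ?_⟩
    fin_cases i
    · exact absurd h (hPQ hi)
    · rfl

theorem possibleCases_three {P Q R : Submodule ℝ g → Prop}
    (hor : ∀ q, IsGenerating q → P q ∨ Q q ∨ R q) (hPQ : ∀ q, IsGenerating q → P q → ¬ Q q)
    (hPR : ∀ q, P q → ¬ R q) (hQR : ∀ q, Q q → ¬ R q)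
    (hP : ∃ q, IsGenerating q ∧ P q) (hQ : ∃ q, IsGenerating q ∧ Q q)
    (hR : ∃ q, IsGenerating q ∧ R q) :
    PossibleCases ![P, Q, R] := by
  refine ⟨fun q hq => ?_, fun i => by fin_cases i <;> assumption⟩
  have hPQ := hPQ q hq
  have hPR := hPR q
  have hQR := hQR q
  rcases hor q hq with h | h | h
  · refine ⟨0, h, fun i hi => ?_⟩
    fin_cases i
    · rfl
    · exact absurd hi (hPQ h)
    · exact absurd hi (hPR h)
  · refine ⟨1, h, fun i hi => ?_⟩
    fin_cases i
    · exact absurd h (hPQ hi)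
    · rfl
    · exact absurd hi (hQR h)
  · refine ⟨2, h, fun i hi => ?_⟩
    fin_cases i
    · exact absurd h (hPR hi)
    · exact absurd h (hQR hi)
    · rfl

/-! ### Extensions of `ℝ` by a three-dimensional abelian ideal -/

section AbelianIdeal

/-- The kernel of the functional `φ` is an abelian ideal, complemented by the line `ℝ T`; thus `g`
is the semidirect product of `ℝ T` and `ker φ`, where `T` acts by `ad T`. -/
structure IsAbelianExtension (φ : g →ₗ[ℝ] ℝ) (T : g) : Prop where
  map_T : φ T = 1
  lie_ker : ∀ x y, φ x = 0 → φ y = 0 → ⁅x, y⁆ = 0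
  map_lie : ∀ x, φ ⁅T, x⁆ = 0

variable {φ : g →ₗ[ℝ] ℝ} {T : g}

theorem IsAbelianExtension.lie_of_mem_ker (h : IsAbelianExtension φ T) (x : g) {v : g}
    (hv : φ v = 0) : ⁅x, v⁆ = φ x • ⁅T, v⁆ := by
  have := h.lie_ker (x - φ x • T) v (by simp [h.map_T]) hv
  rwa [sub_lie, smul_lie, sub_eq_zero] at this

/-- For dimension reasons, the map `v ↦ (φ v, [T, v] mod q)` from `q` to a plane has a kernel. -/
theorem IsAbelianExtension.exists_lie_mem (E : Basis (Fin 4) ℝ g) {q : Submodule ℝ g}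
    (hq : finrank ℝ q = 3) : ∃ v ∈ q, v ≠ 0 ∧ φ v = 0 ∧ ⁅T, v⁆ ∈ q := by
  have : Module.Finite ℝ g := Module.Finite.of_basis E
  let f : q →ₗ[ℝ] ℝ × (g ⧸ q) :=
    ((φ.prod (q.mkQ ∘ₗ (LieAlgebra.ad ℝ g T : g →ₗ[ℝ] g))) ∘ₗ q.subtype)
  have hf : LinearMap.ker f ≠ ⊥ := by
    apply LinearMap.ker_ne_bot_of_finrank_lt
    have h1 := Submodule.finrank_quotient_add_finrank q
    rw [hq, finrank_eq_card_basis E, Fintype.card_fin] at h1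
    rw [finrank_prod, finrank_self, hq]
    omega
  obtain ⟨⟨v, hvq⟩, hv, hv0⟩ := (Submodule.ne_bot_iff _).1 hf
  have hv' : φ v = 0 ∧ ⁅T, v⁆ ∈ q := by
    simpa [f] using LinearMap.mem_ker.1 hv
  exact ⟨v, hvq, fun h => hv0 (Subtype.ext h), hv'⟩

/-- The nonzero `v ∈ q ∩ ker φ` with `[T, v] ∈ q` is either an eigenvector of `ad T`, or it is the
second vector of an adapted basis `(T', v, [T', v])`, where `T' ∈ q` is congruent to `T` modulo the
abelian ideal `ker φ`. -/
theorem IsAbelianExtension.eigenvector_or_hasBasisWith (h : IsAbelianExtension φ T)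
    (E : Basis (Fin 4) ℝ g) {q : Submodule ℝ g} (hq : IsGenerating q) :
    (∃ v ∈ q, v ≠ 0 ∧ φ v = 0 ∧ ∃ l : ℝ, ⁅T, v⁆ = l • v) ∨
      HasBasisWith (fun e => ⁅e 1, e 2⁆ = 0) q := by
  obtain ⟨v, hvq, hv0, hφv, hTv⟩ := IsAbelianExtension.exists_lie_mem (φ := φ) (T := T) E hq.1
  by_cases hl : ∃ l : ℝ, ⁅T, v⁆ = l • v
  · exact Or.inl ⟨v, hvq, hv0, hφv, hl⟩
  right
  obtain ⟨x, hx, hxq⟩ : ∃ x, φ x = 0 ∧ x ∉ q := by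
    by_contra! hall
    -- otherwise `q` would contain, hence equal, the subalgebra `ker φ`
    have hφq : ∀ y ∈ q, φ y = 0 := by
      intro y hy
      by_contra hy0
      have htop : q = ⊤ := by
        rw [eq_top_iff]
        intro z _
        have hz := hall (z - (φ z / φ y) • y) (by simp [hy0])
        simpa using add_mem hz (q.smul_mem (φ z / φ y) hy)
      exact hq.not_forall_lie_mem E fun x _ y _ => htop ▸ Submodule.mem_top
    refine hq.not_forall_lie_mem E fun x hx y hy => ?_
    rw [h.lie_ker x y (hφq x hx) (hφq y hy)]
    exact q.zero_mem
  obtain ⟨c, hc⟩ := exists_add_smul_mem E hq.1 hxq T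
  have hφT : φ (T + c • x) = 1 := by simp [h.map_T, hx]
  have hlie : ⁅T + c • x, v⁆ = ⁅T, v⁆ := by rw [h.lie_of_mem_ker _ hφv, hφT, one_smul]
  have hvw : ⁅v, ⁅T, v⁆⁆ = 0 := h.lie_ker _ _ hφv (h.map_lie v)
  obtain ⟨e, he, h0, h1, h2⟩ := exists_isAdapted E hq hc hvq hTv (fun a b d h0 => by
      have ha : a = 0 := by
        have := congrArg φ h0
        simpa [hφv, h.map_lie, h.map_T, hx] using this
      subst ha
      rw [zero_smul, zero_add] at h0
      have hd : d = 0 := by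
        by_contra hd
        refine hl ⟨-(d⁻¹ * b), ?_⟩
        have h0' : d • ⁅T, v⁆ = -(b • v) := (neg_eq_of_add_eq_zero_right h0).symm
        rw [neg_smul, mul_smul, ← smul_neg, ← h0', inv_smul_smul₀ hd]
      subst hd
      exact ⟨rfl, by simpa [hv0] using h0, rfl⟩)
    (by rw [hlie]; exact hTv) (by rw [hvw]; exact q.zero_mem)
  exact ⟨e, he, by rw [h0, h1, h2, hlie], by simp only [h1, h2, hvw]⟩

/-- A cyclic vector `v` of `ad T` on the abelian ideal gives the hyperplane `⟨T, v, [T, v]⟩`. -/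
theorem IsAbelianExtension.exists_hasBasisWith (h : IsAbelianExtension φ T)
    (E : Basis (Fin 4) ℝ g) {v : g} (hφv : φ v = 0)
    (hli : LinearIndependent ℝ ![T, v, ⁅T, v⁆, ⁅T, ⁅T, v⁆⁆]) :
    ∃ q : Submodule ℝ g, IsGenerating q ∧ HasBasisWith (fun e => ⁅e 1, e 2⁆ = 0) q := by
  have hvw : ⁅v, ⁅T, v⁆⁆ = 0 := h.lie_ker _ _ hφv (h.map_lie v)
  have hgen := isGenerating_span E hli
  obtain ⟨e, he, h0, h1, h2⟩ := exists_isAdapted E hgen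
    (u := T) (v := v) (w := ⁅T, v⁆)
    (Submodule.subset_span (by simp)) (Submodule.subset_span (by simp))
    (Submodule.subset_span (by simp))
    (fun a b c h0 => by
      obtain ⟨ha, hb, hc, -⟩ := eq_zero_of_linearIndependent_four hli
        (show a • T + b • v + c • ⁅T, v⁆ + (0 : ℝ) • ⁅T, ⁅T, v⁆⁆ = 0 by simpa using h0)
      exact ⟨ha, hb, hc⟩)
    (Submodule.subset_span (by simp)) (by rw [hvw]; exact Submodule.zero_mem _)
  exact ⟨_, hgen, e, he, by rw [h0, h1, h2], by simp only [h1, h2, hvw]⟩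

theorem IsAbelianExtension.lie_eq_smul (h : IsAbelianExtension φ T) {v : g} (hφv : φ v = 0)
    {l : ℝ} (hl : ⁅T, v⁆ = l • v) (x : g) : ∃ c : ℝ, ⁅x, v⁆ = c • v :=
  ⟨φ x * l, by rw [h.lie_of_mem_ker x hφv, hl, mul_smul]⟩

/-- If the kernel of `ad T` on the abelian ideal is the line `ℝ z` and `ad T` is not zero, then
the center is `ℝ z`. -/
theorem IsAbelianExtension.central_eq_smul (h : IsAbelianExtension φ T) {z u : g}
    (hz : ∀ x, φ x = 0 → ⁅T, x⁆ = 0 → ∃ c : ℝ, x = c • z) (hφu : φ u = 0)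
    (hu : ⁅T, u⁆ ≠ 0) (x : g) (hx : ∀ y : g, ⁅y, x⁆ = 0) : ∃ c : ℝ, x = c • z := by
  have hφx : φ x = 0 := by
    have h1 := h.lie_of_mem_ker x hφu
    rw [← lie_skew, hx, neg_zero] at h1
    exact (smul_eq_zero_iff_left hu).1 h1.symm
  exact hz x hφx (hx T)

/-- The center case is realised by `⟨T, z, u⟩`, where `z` spans the kernel of `ad T` on the ideal
and `u` is not an eigenvector modulo `z`; the other case by a cyclic vector `w`. -/
theorem IsAbelianExtension.possibleCases_center_basis (h : IsAbelianExtension φ T)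
    (E : Basis (Fin 4) ℝ g) {z u w : g} (hφz : φ z = 0) (hTz : ⁅T, z⁆ = 0)
    (hker : ∀ x, φ x = 0 → ⁅T, x⁆ = 0 → ∃ c : ℝ, x = c • z)
    (heig : ∀ x, φ x = 0 → ∀ l : ℝ, ⁅T, x⁆ = l • x → l ≠ 0 → x = 0)
    (hφu : φ u = 0) (hu : LinearIndependent ℝ ![T, z, u, ⁅T, u⁆])
    (hφw : φ w = 0) (hw : LinearIndependent ℝ ![T, w, ⁅T, w⁆, ⁅T, ⁅T, w⁆⁆]) :
    PossibleCases (g := g) ![ContainsCenter, HasBasisWith fun e => ⁅e 1, e 2⁆ = 0] := by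
  have hz0 : z ≠ 0 := hu.ne_zero 1
  have hTu : ⁅T, u⁆ ≠ 0 := hu.ne_zero 3
  have hzc : ∀ x : g, ⁅x, z⁆ = 0 := fun x => by rw [h.lie_of_mem_ker x hφz, hTz, smul_zero]
  have hcen := h.central_eq_smul hker hφu hTu
  refine possibleCases_two (fun q hq => ?_)
    (fun q hq => not_hasBasisWith_of_containsCenter hq hz0 hzc _)
    ⟨_, isGenerating_span E hu, containsCenter_of_mem (Submodule.subset_span (by simp)) hcen⟩
    (h.exists_hasBasisWith E hφw hw)
  rcases h.eigenvector_or_hasBasisWith E hq with ⟨v, hvq, hv0, hφv, l, hl⟩ | hb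
  · left
    rcases eq_or_ne l 0 with rfl | hl0
    · obtain ⟨c, rfl⟩ := hker v hφv (by rw [hl, zero_smul])
      have hc : c ≠ 0 := by rintro rfl; simp at hv0
      exact containsCenter_of_mem ((q.smul_mem_iff hc).1 hvq) hcen
    · exact absurd (heig v hφv l hl hl0) hv0
  · exact Or.inr hb

/-- The first two cases are realised by `⟨T, z, u⟩` and `⟨T, v, u'⟩`, where `z` and `v` are
eigenvectors of `ad T` with eigenvalue `0` and `l ≠ 0`; the third by a cyclic vector `w`. -/
theorem IsAbelianExtension.possibleCases_center_ideal_basis (h : IsAbelianExtension φ T)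
    (E : Basis (Fin 4) ℝ g) {z u v u' w : g} (hφz : φ z = 0) (hTz : ⁅T, z⁆ = 0)
    (hker : ∀ x, φ x = 0 → ⁅T, x⁆ = 0 → ∃ c : ℝ, x = c • z)
    (hφu : φ u = 0) (hu : LinearIndependent ℝ ![T, z, u, ⁅T, u⁆])
    (hφv : φ v = 0) {l : ℝ} (hl : l ≠ 0) (hTv : ⁅T, v⁆ = l • v)
    (hv : LinearIndependent ℝ ![T, v, u', ⁅T, u'⁆])
    (hφw : φ w = 0) (hw : LinearIndependent ℝ ![T, w, ⁅T, w⁆, ⁅T, ⁅T, w⁆⁆]) :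
    PossibleCases (g := g) ![ContainsCenter, ContainsNoncentralIdeal,
      HasBasisWith fun e => ⁅e 1, e 2⁆ = 0] := by
  have hz0 : z ≠ 0 := hu.ne_zero 1
  have hTu : ⁅T, u⁆ ≠ 0 := hu.ne_zero 3
  have hv0 : v ≠ 0 := hv.ne_zero 1
  have hzc : ∀ x : g, ⁅x, z⁆ = 0 := fun x => by rw [h.lie_of_mem_ker x hφz, hTz, smul_zero]
  have hcen := h.central_eq_smul hker hφu hTu
  refine possibleCases_three (fun q hq => ?_)
    (fun q hq hqc => not_containsNoncentralIdeal E hq hz0 (hqc.mem hzc) hzc)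
    (fun q hq => not_hasBasisWith_of_containsCenter hq hz0 hzc _)
    (fun q hq => not_hasBasisWith_of_containsIdeal hq.containsIdeal _)
    ⟨_, isGenerating_span E hu, containsCenter_of_mem (Submodule.subset_span (by simp)) hcen⟩
    ⟨_, isGenerating_span E hv, containsNoncentralIdeal_of_vector (v := v) (y := T)
      (Submodule.subset_span (by simp)) (h.lie_eq_smul hφv hTv)
      (by rw [hTv]; exact smul_ne_zero hl hv0)⟩
    (h.exists_hasBasisWith E hφw hw)
  rcases h.eigenvector_or_hasBasisWith E hq with ⟨x, hxq, hx0, hφx, k, hk⟩ | hb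
  · rcases eq_or_ne k 0 with rfl | hk0
    · left
      obtain ⟨c, rfl⟩ := hker x hφx (by rw [hk, zero_smul])
      have hc : c ≠ 0 := by rintro rfl; simp at hx0
      exact containsCenter_of_mem ((q.smul_mem_iff hc).1 hxq) hcen
    · right; left
      exact containsNoncentralIdeal_of_vector (v := x) (y := T) hxq (h.lie_eq_smul hφx hk)
        (by rw [hk]; exact smul_ne_zero hk0 hx0)
  · exact Or.inr (Or.inr hb)

theorem IsAbelianExtension.ideal_or_hasBasisWith (h : IsAbelianExtension φ T)
    (E : Basis (Fin 4) ℝ g) (hker : ∀ x, φ x = 0 → ⁅T, x⁆ = 0 → x = 0)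
    {q : Submodule ℝ g} (hq : IsGenerating q) :
    ContainsNoncentralIdeal q ∨ HasBasisWith (fun e => ⁅e 1, e 2⁆ = 0) q := by
  rcases h.eigenvector_or_hasBasisWith E hq with ⟨x, hxq, hx0, hφx, k, hk⟩ | hb
  · exact Or.inl (containsNoncentralIdeal_of_vector (v := x) (y := T) hxq (h.lie_eq_smul hφx hk)
      fun h0 => hx0 (hker x hφx h0))
  · exact Or.inr hb

theorem IsAbelianExtension.possibleCases_ideal_basis (h : IsAbelianExtension φ T)
    (E : Basis (Fin 4) ℝ g) {v u w : g}
    (hker : ∀ x, φ x = 0 → ⁅T, x⁆ = 0 → x = 0)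
    (hφv : φ v = 0) {l : ℝ} (hTv : ⁅T, v⁆ = l • v)
    (hv : LinearIndependent ℝ ![T, v, u, ⁅T, u⁆])
    (hφw : φ w = 0) (hw : LinearIndependent ℝ ![T, w, ⁅T, w⁆, ⁅T, ⁅T, w⁆⁆]) :
    PossibleCases (g := g) ![ContainsNoncentralIdeal,
      HasBasisWith fun e => ⁅e 1, e 2⁆ = 0] :=
  possibleCases_two (fun _ hq => h.ideal_or_hasBasisWith E hker hq)
    (fun _ hq => not_hasBasisWith_of_containsIdeal hq.containsIdeal _)
    ⟨_, isGenerating_span E hv, containsNoncentralIdeal_of_vector (v := v) (y := T)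
      (Submodule.subset_span (by simp)) (h.lie_eq_smul hφv hTv)
      fun h0 => hv.ne_zero 1 (hker v hφv h0)⟩
    (h.exists_hasBasisWith E hφw hw)

/-- An adapted basis with `e 2 = [e 0, e 1]` and `[e 1, e 2] = 0` makes `e 1` a cyclic vector of
`ad T` on the abelian ideal; this is impossible when `ad T` squares to the identity. -/
theorem IsAbelianExtension.not_hasBasisWith_of_sq_eq_one (h : IsAbelianExtension φ T)
    (hsq : ∀ x, φ x = 0 → ⁅T, ⁅T, x⁆⁆ = x) {q : Submodule ℝ g} :
    ¬ HasBasisWith (fun e => ⁅e 1, e 2⁆ = 0) q := by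
  rintro ⟨e, he, h2, h12⟩
  have hφl : ∀ x y : g, φ ⁅x, y⁆ = 0 := by
    intro x y
    have hx := h.lie_of_mem_ker x (v := y - φ y • T) (by simp [h.map_T])
    have hx' : ⁅x, T⁆ = -⁅T, x⁆ := (lie_skew x T).symm
    rw [lie_sub, lie_smul, hx', sub_eq_iff_eq_add] at hx
    rw [hx]
    simp [h.map_lie, -lie_skew]
  have hφ2 : φ (e 2) = 0 := by rw [h2]; exact hφl _ _
  have h20 : φ (e 1) • ⁅T, e 2⁆ = 0 := by rw [← h.lie_of_mem_ker _ hφ2, h12]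
  have h3 : e 3 = φ (e 0) • ⁅T, e 2⁆ := by rw [he.fourth, h.lie_of_mem_ker _ hφ2]
  have hT2 : ⁅T, e 2⁆ ≠ 0 := fun h0 => e.ne_zero 3 (by rw [h3, h0, smul_zero])
  have hφ1 : φ (e 1) = 0 := (smul_eq_zero_iff_left hT2).1 h20
  have h2' : e 2 = φ (e 0) • ⁅T, e 1⁆ := by
    conv_lhs => rw [h2]
    exact h.lie_of_mem_ker _ hφ1
  have h3' : e 3 = (φ (e 0) * φ (e 0)) • e 1 := by
    rw [h3, h2', lie_smul, hsq _ hφ1, mul_smul]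
  have := congrArg (fun x => e.repr x 3) h3'
  simp at this

end AbelianIdeal

/-! ### Computations in coordinates -/

section Coordinates

/-- Linear independence of four vectors from their coordinate determinant, written out by the
Laplace expansion along two columns. -/
theorem linearIndependent_of_minors_ne_zero (E : Basis (Fin 4) ℝ g) {u v w z : g}
    (h : (E.repr u 0 * E.repr v 1 - E.repr u 1 * E.repr v 0) *
          (E.repr w 2 * E.repr z 3 - E.repr w 3 * E.repr z 2) -
        (E.repr u 0 * E.repr v 2 - E.repr u 2 * E.repr v 0) *
          (E.repr w 1 * E.repr z 3 - E.repr w 3 * E.repr z 1) +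
        (E.repr u 0 * E.repr v 3 - E.repr u 3 * E.repr v 0) *
          (E.repr w 1 * E.repr z 2 - E.repr w 2 * E.repr z 1) +
        (E.repr u 1 * E.repr v 2 - E.repr u 2 * E.repr v 1) *
          (E.repr w 0 * E.repr z 3 - E.repr w 3 * E.repr z 0) -
        (E.repr u 1 * E.repr v 3 - E.repr u 3 * E.repr v 1) *
          (E.repr w 0 * E.repr z 2 - E.repr w 2 * E.repr z 0) +
        (E.repr u 2 * E.repr v 3 - E.repr u 3 * E.repr v 2) *
          (E.repr w 0 * E.repr z 1 - E.repr w 1 * E.repr z 0) ≠ 0) :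
    LinearIndependent ℝ ![u, v, w, z] := by
  refine ((Basis.is_basis_iff_det E).2 ?_).1
  rw [Basis.det_apply]
  refine IsUnit.mk0 _ (ne_of_eq_of_ne ?_ h)
  simp [Matrix.det_succ_row_zero, Basis.toMatrix_apply, Fin.sum_univ_succ, Fin.succAbove]
  ring

theorem Basis.eq_sum_four (E : Basis (Fin 4) ℝ g) (x : g) :
    x = E.repr x 0 • E 0 + E.repr x 1 • E 1 + E.repr x 2 • E 2 + E.repr x 3 • E 3 := by
  conv_lhs => rw [← E.sum_repr x, Fin.sum_univ_four]

theorem HasBrackets.lie_eq {E : Basis (Fin 4) ℝ g} {v12 v13 v14 v23 v24 v34 : g}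
    (h : HasBrackets E v12 v13 v14 v23 v24 v34) (x y : g) :
    ⁅x, y⁆ =
      (E.repr x 0 * E.repr y 1 - E.repr x 1 * E.repr y 0) • v12 +
      (E.repr x 0 * E.repr y 2 - E.repr x 2 * E.repr y 0) • v13 +
      (E.repr x 0 * E.repr y 3 - E.repr x 3 * E.repr y 0) • v14 +
      (E.repr x 1 * E.repr y 2 - E.repr x 2 * E.repr y 1) • v23 +
      (E.repr x 1 * E.repr y 3 - E.repr x 3 * E.repr y 1) • v24 +
      (E.repr x 2 * E.repr y 3 - E.repr x 3 * E.repr y 2) • v34 := by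
  obtain ⟨h12, h13, h14, h23, h24, h34⟩ := h
  have k12 : ⁅E 1, E 0⁆ = -v12 := by rw [← lie_skew, h12]
  have k13 : ⁅E 2, E 0⁆ = -v13 := by rw [← lie_skew, h13]
  have k14 : ⁅E 3, E 0⁆ = -v14 := by rw [← lie_skew, h14]
  have k23 : ⁅E 2, E 1⁆ = -v23 := by rw [← lie_skew, h23]
  have k24 : ⁅E 3, E 1⁆ = -v24 := by rw [← lie_skew, h24]
  have k34 : ⁅E 3, E 2⁆ = -v34 := by rw [← lie_skew, h34]
  conv_lhs => rw [Basis.eq_sum_four E x, Basis.eq_sum_four E y]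
  simp only [lie_add, add_lie, smul_lie, lie_smul, lie_self, h12, h13, h14, h23, h24, h34,
    k12, k13, k14, k23, k24, k34]
  module

theorem Basis.ext_repr_four (E : Basis (Fin 4) ℝ g) {x y : g} (h0 : E.repr x 0 = E.repr y 0)
    (h1 : E.repr x 1 = E.repr y 1) (h2 : E.repr x 2 = E.repr y 2)
    (h3 : E.repr x 3 = E.repr y 3) : x = y := by
  rw [Basis.eq_sum_four E x, Basis.eq_sum_four E y, h0, h1, h2, h3]

/-- Brackets of the form `[E₁,E₄], [E₂,E₄], [E₃,E₄] ∈ ⟨E₁,E₂,E₃⟩`, all others zero, present `g` as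
an extension by the abelian ideal `⟨E₁,E₂,E₃⟩`. -/
theorem isAbelianExtension_coord_three {E : Basis (Fin 4) ℝ g} {w1 w2 w3 : g}
    (h : HasBrackets E 0 0 w1 0 w2 w3) (h1 : E.repr w1 3 = 0) (h2 : E.repr w2 3 = 0)
    (h3 : E.repr w3 3 = 0) : IsAbelianExtension (E.coord 3) (E 3) where
  map_T := by simp
  lie_ker x y hx hy := by
    rw [Basis.coord_apply] at hx hy
    simp [h.lie_eq x y, hx, hy]
  map_lie x := by simp [h.lie_eq, h1, h2, h3]

/-- The same with `E₃` in place of `E₄`: here `E₄` is a central direct summand. -/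
theorem isAbelianExtension_coord_two {E : Basis (Fin 4) ℝ g} {w1 w2 : g}
    (h : HasBrackets E 0 w1 0 w2 0 0) (h1 : E.repr w1 2 = 0) (h2 : E.repr w2 2 = 0) :
    IsAbelianExtension (E.coord 2) (E 2) where
  map_T := by simp
  lie_ker x y hx hy := by
    rw [Basis.coord_apply] at hx hy
    simp [h.lie_eq x y, hx, hy]
  map_lie x := by simp [h.lie_eq, h1, h2]

end Coordinates

/-! ### The algebras with an abelian ideal of dimension three -/

section AbelianAlgebras

variable {E : Basis (Fin 4) ℝ g}

/-- `ad E₃` is a Jordan block with eigenvalue `1` on `⟨E₁, E₂⟩`, and zero on `E₄`. -/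
theorem G32G1.possibleCases (h : G32G1 E) :
    PossibleCases (g := g) ![ContainsCenter, ContainsNoncentralIdeal,
      HasBasisWith fun e => ⁅e 1, e 2⁆ = 0] := by
  have hext := isAbelianExtension_coord_two h (by simp) (by simp)
  refine hext.possibleCases_center_ideal_basis E (z := E 3) (u := E 1) (v := E 0)
    (u' := E 1 + E 3) (w := E 1 + E 3) (l := 1) ?_ ?_ ?_ ?_ ?_ ?_ ?_ ?_ ?_ ?_ ?_
  · simp
  · simp [h.lie_eq]
  · intro x hx hT
    rw [Basis.coord_apply] at hx
    have e0 := congrArg (fun y => E.repr y 0) hT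
    have e1 := congrArg (fun y => E.repr y 1) hT
    simp [h.lie_eq] at e0 e1
    have x1 : E.repr x 1 = 0 := by linarith
    have x0 : E.repr x 0 = 0 := by linarith
    exact ⟨E.repr x 3, by apply Basis.ext_repr_four E <;> simp [hx, x0, x1]⟩
  · simp
  · apply linearIndependent_of_minors_ne_zero E
    simp [h.lie_eq]
  · simp
  · norm_num
  · apply Basis.ext_repr_four E <;> simp [h.lie_eq]
  · apply linearIndependent_of_minors_ne_zero E
    simp [h.lie_eq]
  · simp
  · apply linearIndependent_of_minors_ne_zero E
    simp [h.lie_eq]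

/-- `ad E₃` has the eigenvalues `α + 1` (on `E₁ - E₂`), `α - 1` (on `E₁ + E₂`) and `0` (on `E₄`). -/
theorem G34G1.possibleCases {α : ℝ} (h0 : 0 ≤ α) (h1 : α ≠ 1) (h : G34G1 α E) :
    PossibleCases (g := g) ![ContainsCenter, ContainsNoncentralIdeal,
      HasBasisWith fun e => ⁅e 1, e 2⁆ = 0] := by
  have hext := isAbelianExtension_coord_two h (by simp) (by simp)
  refine hext.possibleCases_center_ideal_basis E (z := E 3) (u := E 0) (v := E 0 - E 1)
    (u' := E 0 + E 3) (w := E 0 + E 3) (l := α + 1) ?_ ?_ ?_ ?_ ?_ ?_ ?_ ?_ ?_ ?_ ?_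
  · simp
  · simp [h.lie_eq]
  · intro x hx hT
    rw [Basis.coord_apply] at hx
    have e0 := congrArg (fun y => E.repr y 0) hT
    have e1 := congrArg (fun y => E.repr y 1) hT
    simp [h.lie_eq] at e0 e1
    have hα : (α - 1) * (α + 1) ≠ 0 := mul_ne_zero (sub_ne_zero.2 h1) (by positivity)
    have x0 : E.repr x 0 = 0 := (mul_eq_zero_iff_left hα).1 (by linear_combination α * e0 + e1)
    have x1 : E.repr x 1 = 0 := (mul_eq_zero_iff_left hα).1 (by linear_combination e0 + α * e1)
    exact ⟨E.repr x 3, by apply Basis.ext_repr_four E <;> simp [hx, x0, x1]⟩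
  · simp
  · apply linearIndependent_of_minors_ne_zero E
    simp [h.lie_eq]
  · simp
  · positivity
  · apply Basis.ext_repr_four E <;> simp [h.lie_eq]
  · apply linearIndependent_of_minors_ne_zero E
    simp [h.lie_eq]
    intro h0
    apply h1
    linarith
  · simp
  · apply linearIndependent_of_minors_ne_zero E
    simp [h.lie_eq]
    intro h0
    have hα : (α - 1) * (α + 1) ≠ 0 := mul_ne_zero (sub_ne_zero.2 h1) (by positivity)
    apply hα
    linear_combination -h0

/-- `ad E₄` has the eigenvalue `-1` on `E₁` and is a nilpotent Jordan block on `⟨E₂, E₃⟩`. -/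
theorem G43.possibleCases (h : G43 E) :
    PossibleCases (g := g) ![ContainsCenter, ContainsNoncentralIdeal,
      HasBasisWith fun e => ⁅e 1, e 2⁆ = 0] := by
  have hext := isAbelianExtension_coord_three h (by simp) (by simp) (by simp)
  refine hext.possibleCases_center_ideal_basis E (z := E 1) (u := E 0 + E 2) (v := E 0)
    (u' := E 2) (w := E 0 + E 2) (l := -1) ?_ ?_ ?_ ?_ ?_ ?_ ?_ ?_ ?_ ?_ ?_
  · simp
  · simp [h.lie_eq]
  · intro x hx hT
    rw [Basis.coord_apply] at hx
    have e0 := congrArg (fun y => E.repr y 0) hT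
    have e1 := congrArg (fun y => E.repr y 1) hT
    simp [h.lie_eq] at e0 e1
    exact ⟨E.repr x 1, by apply Basis.ext_repr_four E <;> simp [hx, e0, e1]⟩
  · simp
  · apply linearIndependent_of_minors_ne_zero E
    simp [h.lie_eq]
  · simp
  · norm_num
  · apply Basis.ext_repr_four E <;> simp [h.lie_eq]
  · apply linearIndependent_of_minors_ne_zero E
    simp [h.lie_eq]
  · simp
  · apply linearIndependent_of_minors_ne_zero E
    simp [h.lie_eq]

/-- `ad E₃` has the eigenvalues `α ± i` on `⟨E₁, E₂⟩` and `0` on `E₄`. -/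
theorem G35G1.possibleCases {α : ℝ} (h : G35G1 α E) :
    PossibleCases (g := g) ![ContainsCenter, HasBasisWith fun e => ⁅e 1, e 2⁆ = 0] := by
  have hext := isAbelianExtension_coord_two h (by simp) (by simp)
  refine hext.possibleCases_center_basis E (z := E 3) (u := E 0) (w := E 0 + E 3)
    ?_ ?_ ?_ ?_ ?_ ?_ ?_ ?_
  · simp
  · simp [h.lie_eq]
  · intro x hx hT
    rw [Basis.coord_apply] at hx
    have e0 := congrArg (fun y => E.repr y 0) hT
    have e1 := congrArg (fun y => E.repr y 1) hT
    simp [h.lie_eq] at e0 e1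
    have hα : α * α + 1 ≠ 0 := by nlinarith [mul_self_nonneg α]
    have x0 : E.repr x 0 = 0 := (mul_eq_zero_iff_left hα).1 (by linear_combination α * e0 + e1)
    have x1 : E.repr x 1 = 0 := (mul_eq_zero_iff_left hα).1 (by linear_combination -e0 + α * e1)
    exact ⟨E.repr x 3, by apply Basis.ext_repr_four E <;> simp [hx, x0, x1]⟩
  · intro x hx l hT hl
    rw [Basis.coord_apply] at hx
    have e0 := congrArg (fun y => E.repr y 0) hT
    have e1 := congrArg (fun y => E.repr y 1) hT
    have e3 := congrArg (fun y => E.repr y 3) hT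
    simp [h.lie_eq, hl, hx] at e0 e1 e3
    have hα : (α - l) * (α - l) + 1 ≠ 0 := by nlinarith [mul_self_nonneg (α - l)]
    have x0 : E.repr x 0 = 0 :=
      (mul_eq_zero_iff_left hα).1 (by linear_combination (α - l) * e0 + e1)
    have x1 : E.repr x 1 = 0 :=
      (mul_eq_zero_iff_left hα).1 (by linear_combination -e0 + (α - l) * e1)
    apply Basis.ext_repr_four E <;> simp [hx, x0, x1, e3]
  · simp
  · apply linearIndependent_of_minors_ne_zero E
    simp [h.lie_eq]
  · simp
  · apply linearIndependent_of_minors_ne_zero E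
    simp [h.lie_eq]
    nlinarith [mul_self_nonneg α]

/-- `ad E₄` is a nilpotent Jordan block on `⟨E₁, E₂, E₃⟩`. -/
theorem G41.possibleCases (h : G41 E) :
    PossibleCases (g := g) ![ContainsCenter, HasBasisWith fun e => ⁅e 1, e 2⁆ = 0] := by
  have hext := isAbelianExtension_coord_three h (by simp) (by simp) (by simp)
  refine hext.possibleCases_center_basis E (z := E 0) (u := E 2) (w := E 2)
    ?_ ?_ ?_ ?_ ?_ ?_ ?_ ?_
  · simp
  · simp [h.lie_eq]
  · intro x hx hT
    rw [Basis.coord_apply] at hx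
    have e0 := congrArg (fun y => E.repr y 0) hT
    have e1 := congrArg (fun y => E.repr y 1) hT
    simp [h.lie_eq] at e0 e1
    exact ⟨E.repr x 0, by apply Basis.ext_repr_four E <;> simp [hx, e0, e1]⟩
  · intro x hx l hT hl
    rw [Basis.coord_apply] at hx
    have e0 := congrArg (fun y => E.repr y 0) hT
    have e1 := congrArg (fun y => E.repr y 1) hT
    have e2 := congrArg (fun y => E.repr y 2) hT
    simp [h.lie_eq, hl, hx] at e0 e1 e2
    have x1 : E.repr x 1 = 0 := (mul_eq_zero_iff_left hl).1 (by linear_combination -e1 - e2)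
    have x0 : E.repr x 0 = 0 := (mul_eq_zero_iff_left hl).1 (by linear_combination -e0 - x1)
    apply Basis.ext_repr_four E <;> simp [hx, x0, x1, e2]
  · simp
  · apply linearIndependent_of_minors_ne_zero E
    simp [h.lie_eq]
  · simp
  · apply linearIndependent_of_minors_ne_zero E
    simp [h.lie_eq]

/-- `E₁ + E₃` is cyclic, as `-ad E₄` has the eigenvalue `α` on `E₁` and is a Jordan block with
eigenvalue `1 ≠ α` on `⟨E₂, E₃⟩`. -/
theorem G42.possibleCases {α : ℝ} (h0 : α ≠ 0) (h1 : α ≠ 1) (h : G42 α E) :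
    PossibleCases (g := g) ![ContainsNoncentralIdeal,
      HasBasisWith fun e => ⁅e 1, e 2⁆ = 0] := by
  have hext := isAbelianExtension_coord_three h (by simp) (by simp) (by simp)
  refine hext.possibleCases_ideal_basis E (v := E 0) (u := E 2) (w := E 0 + E 2) (l := -α)
    ?_ ?_ ?_ ?_ ?_ ?_
  · intro x hx hT
    rw [Basis.coord_apply] at hx
    have e0 := congrArg (fun y => E.repr y 0) hT
    have e1 := congrArg (fun y => E.repr y 1) hT
    have e2 := congrArg (fun y => E.repr y 2) hT
    simp [h.lie_eq] at e0 e1 e2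
    simp [h0] at e0
    simp [e2] at e1
    apply Basis.ext_repr_four E <;> simp [hx, e0, e1, e2]
  · simp
  · apply Basis.ext_repr_four E <;> simp [h.lie_eq]
  · apply linearIndependent_of_minors_ne_zero E
    simp [h.lie_eq]
  · simp
  · apply linearIndependent_of_minors_ne_zero E
    simp [h.lie_eq]
    intro h2
    apply mul_self_ne_zero.2 (sub_ne_zero.2 h1)
    linear_combination -h2

/-- `-ad E₄` is a Jordan block with eigenvalue `1` on `⟨E₁, E₂, E₃⟩`. -/
theorem G44.possibleCases (h : G44 E) :
    PossibleCases (g := g) ![ContainsNoncentralIdeal,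
      HasBasisWith fun e => ⁅e 1, e 2⁆ = 0] := by
  have hext := isAbelianExtension_coord_three h (by simp) (by simp) (by simp)
  refine hext.possibleCases_ideal_basis E (v := E 0) (u := E 2) (w := E 2) (l := -1)
    ?_ ?_ ?_ ?_ ?_ ?_
  · intro x hx hT
    rw [Basis.coord_apply] at hx
    have e0 := congrArg (fun y => E.repr y 0) hT
    have e1 := congrArg (fun y => E.repr y 1) hT
    have e2 := congrArg (fun y => E.repr y 2) hT
    simp [h.lie_eq] at e0 e1 e2
    simp [e2] at e1
    simp [e1] at e0
    apply Basis.ext_repr_four E <;> simp [hx, e0, e1, e2]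
  · simp
  · apply Basis.ext_repr_four E <;> simp [h.lie_eq]
  · apply linearIndependent_of_minors_ne_zero E
    simp [h.lie_eq]
  · simp
  · apply linearIndependent_of_minors_ne_zero E
    simp [h.lie_eq]

/-- `E₁ + E₂ + E₃` is cyclic, as the eigenvalues `1, β, α` of `-ad E₄` are distinct. -/
theorem G45.possibleCases {α β : ℝ} (hα : α ≠ 0) (hβ : β ≠ 0) (hαβ : α ≠ β) (hα1 : α ≠ 1)
    (hβ1 : β ≠ 1) (h : G45 α β E) :
    PossibleCases (g := g) ![ContainsNoncentralIdeal,
      HasBasisWith fun e => ⁅e 1, e 2⁆ = 0] := by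
  have hext := isAbelianExtension_coord_three h (by simp) (by simp) (by simp)
  refine hext.possibleCases_ideal_basis E (v := E 0) (u := E 1 + E 2) (w := E 0 + E 1 + E 2)
    (l := -1)
    ?_ ?_ ?_ ?_ ?_ ?_
  · intro x hx hT
    rw [Basis.coord_apply] at hx
    have e0 := congrArg (fun y => E.repr y 0) hT
    have e1 := congrArg (fun y => E.repr y 1) hT
    have e2 := congrArg (fun y => E.repr y 2) hT
    simp [h.lie_eq] at e0 e1 e2
    simp [hα] at e2
    simp [hβ] at e1
    apply Basis.ext_repr_four E <;> simp [hx, e0, e1, e2]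
  · simp
  · apply Basis.ext_repr_four E <;> simp [h.lie_eq]
  · apply linearIndependent_of_minors_ne_zero E
    simp [h.lie_eq]
    intro h2
    apply hαβ
    linarith
  · simp
  · apply linearIndependent_of_minors_ne_zero E
    simp [h.lie_eq]
    intro h2
    have := mul_ne_zero (mul_ne_zero (sub_ne_zero.2 hαβ) (sub_ne_zero.2 hα1)) (sub_ne_zero.2 hβ1)
    apply this
    linear_combination h2

/-- `-ad E₄` has the eigenvalue `α` on `E₁` and `β ± i` on `⟨E₂, E₃⟩`. -/
theorem G46.possibleCases {α β : ℝ} (hα : 0 < α) (h : G46 α β E) :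
    PossibleCases (g := g) ![ContainsNoncentralIdeal,
      HasBasisWith fun e => ⁅e 1, e 2⁆ = 0] := by
  have hext := isAbelianExtension_coord_three h (by simp) (by simp) (by simp)
  refine hext.possibleCases_ideal_basis E (v := E 0) (u := E 1) (w := E 0 + E 1) (l := -α)
    ?_ ?_ ?_ ?_ ?_ ?_
  · intro x hx hT
    rw [Basis.coord_apply] at hx
    have e0 := congrArg (fun y => E.repr y 0) hT
    have e1 := congrArg (fun y => E.repr y 1) hT
    have e2 := congrArg (fun y => E.repr y 2) hT
    simp [h.lie_eq] at e0 e1 e2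
    simp [hα.ne'] at e0
    have hβ : β * β + 1 ≠ 0 := by nlinarith [mul_self_nonneg β]
    have x1 : E.repr x 1 = 0 := (mul_eq_zero_iff_left hβ).1 (by linear_combination e2 - β * e1)
    have x2 : E.repr x 2 = 0 := (mul_eq_zero_iff_left hβ).1 (by linear_combination -e1 - β * e2)
    apply Basis.ext_repr_four E <;> simp [hx, e0, x1, x2]
  · simp
  · apply Basis.ext_repr_four E <;> simp [h.lie_eq]
  · apply linearIndependent_of_minors_ne_zero E
    simp [h.lie_eq]
  · simp
  · apply linearIndependent_of_minors_ne_zero E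
    simp [h.lie_eq]
    nlinarith [mul_self_nonneg (α - β)]

/-- Here `(ad E₄)² = 1` on the abelian ideal, so that no vector is cyclic. -/
theorem G45.containsNoncentralIdeal_of_isGenerating (h : G45 (-1) 1 E) :
    (∃ q : Submodule ℝ g, IsGenerating q) ∧
      ∀ q : Submodule ℝ g, IsGenerating q →
        ContainsNoncentralIdeal q ∧ ¬ HasBasisWith (fun e => ⁅e 1, e 2⁆ = 0) q := by
  have hext := isAbelianExtension_coord_three h (by simp) (by simp) (by simp)
  have hsq : ∀ x, E.coord 3 x = 0 → ⁅E 3, ⁅E 3, x⁆⁆ = x := by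
    intro x hx
    rw [Basis.coord_apply] at hx
    apply Basis.ext_repr_four E <;> simp [h.lie_eq, hx]
  refine ⟨⟨_, isGenerating_span E (u := E 3) (v := E 0) (w := E 1 + E 2) ?_⟩, fun q hq => ?_⟩
  · apply linearIndependent_of_minors_ne_zero E
    simp [h.lie_eq]
  · have hn := hext.not_hasBasisWith_of_sq_eq_one hsq (q := q)
    refine ⟨(hext.ideal_or_hasBasisWith E (fun x hx h0 => ?_) hq).resolve_right hn, hn⟩
    rw [← hsq x hx, h0, lie_zero]

end AbelianAlgebras

/-! ### Extensions of `ℝ` by the Heisenberg algebra -/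

section Heisenberg

variable {E : Basis (Fin 4) ℝ g} {p r s t : ℝ}

/-- The common form of `g_{4,7}`, `g_{4,8}^α` and `g_{4,9}^α`: the span of `E₁, E₂, E₃` is the
Heisenberg algebra with `[E₂, E₃] = E₁`, and `-ad E₄` acts on it modulo `E₁` by the matrix with
rows `(p, r)` and `(s, t)`, hence on `E₁` by its trace `p + t`. -/
def IsHeisenbergExtension (p r s t : ℝ) (E : Basis (Fin 4) ℝ g) : Prop :=
  HasBrackets E 0 0 ((p + t) • E 0) (E 0) (p • E 1 + r • E 2) (s • E 1 + t • E 2)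

/-- If `E₁ ∉ q`, then `q` has a basis `F₂, F₃, F₄` with `Fᵢ ≡ Eᵢ` modulo `E₁`. The second vector `v`
of an adapted basis is `F₄` corrected by a combination of `F₂` and `F₃`, and `-ad v` acts on the
span of `F₂, F₃` exactly by the matrix of the extension; the first vector is `u = m F₂ + n F₃`,
cyclic for this matrix. -/
theorem IsHeisenbergExtension.hasBasisWith (h : IsHeisenbergExtension p r s t E) {m n : ℝ}
    (hcyc : m * (m * r + n * t) - n * (m * p + n * s) ≠ 0)
    {q : Submodule ℝ g} (hq : IsGenerating q) (hE : E 0 ∉ q) :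
    HasBasisWith (fun e => structConst e 1 2 0 = p * t - r * s ∧ structConst e 1 2 1 = 0) q := by
  obtain ⟨a, ha⟩ := exists_add_smul_mem E hq.1 hE (E 1)
  obtain ⟨b, hb⟩ := exists_add_smul_mem E hq.1 hE (E 2)
  obtain ⟨c, hc⟩ := exists_add_smul_mem E hq.1 hE (E 3)
  obtain ⟨F1, hF1⟩ : ∃ F1, F1 = E 1 + a • E 0 := ⟨_, rfl⟩
  obtain ⟨F2, hF2⟩ : ∃ F2, F2 = E 2 + b • E 0 := ⟨_, rfl⟩
  obtain ⟨v, hv⟩ : ∃ v, v = E 3 + c • E 0 + (p * b - s * a) • F1 + (r * b - a * t) • F2 :=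
    ⟨_, rfl⟩
  have h1 : ⁅F1, v⁆ = p • F1 + r • F2 := by
    rw [h.lie_eq]
    simp [hv, hF1, hF2]
    module
  have h2 : ⁅F2, v⁆ = s • F1 + t • F2 := by
    rw [h.lie_eq]
    simp [hv, hF1, hF2]
    module
  rw [← hF1] at ha
  rw [← hF2] at hb
  have hvq : v ∈ q := by
    rw [hv]
    exact add_mem (add_mem hc (q.smul_mem _ ha)) (q.smul_mem _ hb)
  obtain ⟨u, hu⟩ : ∃ u, u = m • F1 + n • F2 := ⟨_, rfl⟩
  obtain ⟨w, hw⟩ : ∃ w, w = (m * p + n * s) • F1 + (m * r + n * t) • F2 := ⟨_, rfl⟩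
  have huv : ⁅u, v⁆ = w := by
    rw [hu, hw, add_lie, smul_lie, smul_lie, h1, h2]
    module
  have hvw : ⁅v, w⁆ = (p * t - r * s) • u + -(p + t) • w := by
    rw [← lie_skew, hu, hw, add_lie, smul_lie, smul_lie, h1, h2]
    module
  have huq : u ∈ q := by
    rw [hu]
    exact add_mem (q.smul_mem _ ha) (q.smul_mem _ hb)
  have hwq : w ∈ q := by
    rw [hw]
    exact add_mem (q.smul_mem _ ha) (q.smul_mem _ hb)
  obtain ⟨e, he, e0, e1, e2⟩ := exists_isAdapted E hq huq hvq hwq (fun x y z h0 => by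
      have k1 := congrArg (fun y => E.repr y 1) h0
      have k2 := congrArg (fun y => E.repr y 2) h0
      have k3 := congrArg (fun y => E.repr y 3) h0
      simp [hu, hv, hw, hF1, hF2] at k1 k2 k3
      subst k3
      refine ⟨(mul_eq_zero_iff_left hcyc).1 ?_, rfl, (mul_eq_zero_iff_left hcyc).1 ?_⟩
      · linear_combination (m * r + n * t) * k1 - (m * p + n * s) * k2
      · linear_combination m * k2 - n * k1)
    (by rw [huv]; exact hwq)
    (by rw [hvw]; exact add_mem (q.smul_mem _ huq) (q.smul_mem _ hwq))
  refine ⟨e, he, by rw [e0, e1, e2, huv], ?_⟩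
  have h12 : ⁅e 1, e 2⁆ = (p * t - r * s) • e 0 + -(p + t) • e 2 := by rw [e0, e1, e2, hvw]
  simp [structConst, h12]

theorem IsHeisenbergExtension.lie_zero (h : IsHeisenbergExtension p r s t E) (x : g) :
    ⁅x, E 0⁆ = (-((p + t) * E.repr x 3)) • E 0 := by
  rw [h.lie_eq]
  simp
  module

/-- The hyperplane `⟨E₄, E₁, m E₂ + n E₃⟩` is generating if `(m, n)` is a cyclic vector. -/
theorem IsHeisenbergExtension.linearIndependent (h : IsHeisenbergExtension p r s t E) {m n : ℝ}
    (hcyc : m * (m * r + n * t) - n * (m * p + n * s) ≠ 0) :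
    LinearIndependent ℝ ![E 3, E 0, m • E 1 + n • E 2, ⁅E 3, m • E 1 + n • E 2⁆] := by
  apply linearIndependent_of_minors_ne_zero E
  rw [h.lie_eq]
  simp
  intro h0
  exact hcyc (by linear_combination h0)

theorem IsHeisenbergExtension.exists_notMem (h : IsHeisenbergExtension p r s t E) :
    ∃ q : Submodule ℝ g, IsGenerating q ∧ E 0 ∉ q := by
  have hlie : ⁅E 1, E 2⁆ = E 0 := h.2.2.2.1
  have hgen := isGenerating_span E (u := E 1) (v := E 3) (w := E 2) (by
    apply linearIndependent_of_minors_ne_zero E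
    rw [hlie]
    simp)
  refine ⟨_, hgen, ?_⟩
  rw [Submodule.mem_span_triple]
  rintro ⟨a, b, c, habc⟩
  have := congrArg (fun y => E.repr y 0) habc
  simp at this

/-- For nonzero trace, `ℝ E₁` is a noncentral ideal. -/
theorem IsHeisenbergExtension.possibleCases_ideal (h : IsHeisenbergExtension p r s t E) {m n : ℝ}
    (hcyc : m * (m * r + n * t) - n * (m * p + n * s) ≠ 0) (htr : p + t ≠ 0)
    {P : Basis (Fin 4) ℝ g → Prop}
    (hP : ∀ e, structConst e 1 2 0 = p * t - r * s ∧ structConst e 1 2 1 = 0 → P e) :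
    PossibleCases (g := g) ![ContainsNoncentralIdeal, HasBasisWith P] := by
  have hideal : ∀ q : Submodule ℝ g, E 0 ∈ q → ContainsNoncentralIdeal q := fun q hq =>
    containsNoncentralIdeal_of_vector (y := E 3) hq (fun x => ⟨_, h.lie_zero x⟩) (by
      rw [h.lie_zero]
      exact smul_ne_zero (by
        rw [E.repr_self, Finsupp.single_eq_same, mul_one]
        exact neg_ne_zero.2 htr) (E.ne_zero 0))
  have hbasis : ∀ q : Submodule ℝ g, IsGenerating q → E 0 ∉ q → HasBasisWith P q :=
    fun q hq hE => by
      obtain ⟨e, he, h2, hs⟩ := h.hasBasisWith hcyc hq hE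
      exact ⟨e, he, h2, hP e hs⟩
  obtain ⟨q, hq, hE⟩ := h.exists_notMem
  refine possibleCases_two (fun q hq => ?_)
    (fun q hq => not_hasBasisWith_of_containsIdeal hq.containsIdeal _)
    ⟨_, isGenerating_span E (h.linearIndependent hcyc),
      hideal _ (Submodule.subset_span (by simp))⟩ ⟨q, hq, hbasis q hq hE⟩
  by_cases hE : E 0 ∈ q
  · exact Or.inl (hideal q hE)
  · exact Or.inr (hbasis q hq hE)

/-- For trace zero, `ℝ E₁` is the center. -/
theorem IsHeisenbergExtension.possibleCases_center (h : IsHeisenbergExtension p r s t E) {m n : ℝ}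
    (hcyc : m * (m * r + n * t) - n * (m * p + n * s) ≠ 0) (htr : p + t = 0)
    {P : Basis (Fin 4) ℝ g → Prop}
    (hP : ∀ e, structConst e 1 2 0 = p * t - r * s ∧ structConst e 1 2 1 = 0 → P e) :
    PossibleCases (g := g) ![ContainsCenter, HasBasisWith P] := by
  have hzc : ∀ x : g, ⁅x, E 0⁆ = 0 := fun x => by rw [h.lie_zero, htr]; simp
  have hcen : ∀ x : g, (∀ y : g, ⁅y, x⁆ = 0) → ∃ c : ℝ, x = c • E 0 := by
    intro x hx
    have hx1 := hx (E 1)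
    have hx2 := hx (E 2)
    rw [h.lie_eq] at hx1 hx2
    have k1 := congrArg (fun y => E.repr y 0) hx1
    have k2 := congrArg (fun y => E.repr y 0) hx2
    have k3 := congrArg (fun y => E.repr y 1) hx1
    have k4 := congrArg (fun y => E.repr y 2) hx1
    have k5 := congrArg (fun y => E.repr y 1) hx2
    have k6 := congrArg (fun y => E.repr y 2) hx2
    simp [-mul_eq_zero] at k1 k2 k3 k4 k5 k6
    have x3 : E.repr x 3 = 0 := (mul_eq_zero_iff_left hcyc).1 (by
      linear_combination m * m * k4 + m * n * k6 - n * m * k3 - n * n * k5)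
    exact ⟨E.repr x 0, by apply Basis.ext_repr_four E <;> simp [k1, k2, x3]⟩
  have hcenter : ∀ q : Submodule ℝ g, E 0 ∈ q → ContainsCenter q := fun q hq =>
    containsCenter_of_mem hq hcen
  have hbasis : ∀ q : Submodule ℝ g, IsGenerating q → E 0 ∉ q → HasBasisWith P q :=
    fun q hq hE => by
      obtain ⟨e, he, h2, hs⟩ := h.hasBasisWith hcyc hq hE
      exact ⟨e, he, h2, hP e hs⟩
  obtain ⟨q, hq, hE⟩ := h.exists_notMem
  refine possibleCases_two (fun q hq => ?_)
    (fun q hq => not_hasBasisWith_of_containsCenter hq (E.ne_zero 0) hzc _)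
    ⟨_, isGenerating_span E (h.linearIndependent hcyc),
      hcenter _ (Submodule.subset_span (by simp))⟩ ⟨q, hq, hbasis q hq hE⟩
  by_cases hE : E 0 ∈ q
  · exact Or.inl (hcenter q hE)
  · exact Or.inr (hbasis q hq hE)

theorem G47.isHeisenbergExtension (h : G47 E) : IsHeisenbergExtension 1 0 1 1 E := by
  unfold IsHeisenbergExtension
  have h2 : ((1 : ℝ) + 1) • E 0 = (2 : ℝ) • E 0 := by module
  have h3 : (1 : ℝ) • E 1 + (0 : ℝ) • E 2 = E 1 := by module
  have h4 : (1 : ℝ) • E 1 + (1 : ℝ) • E 2 = E 1 + E 2 := by module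
  rw [h2, h3, h4]
  exact h

theorem G48.isHeisenbergExtension {α : ℝ} (h : G48 α E) :
    IsHeisenbergExtension 1 0 0 α E := by
  unfold IsHeisenbergExtension
  have h3 : (1 : ℝ) • E 1 + (0 : ℝ) • E 2 = E 1 := by module
  have h4 : (0 : ℝ) • E 1 + α • E 2 = α • E 2 := by module
  rw [h3, h4]
  exact h

theorem G49.isHeisenbergExtension {α : ℝ} (h : G49 α E) :
    IsHeisenbergExtension α (-1) 1 α E := by
  unfold IsHeisenbergExtension
  have h3 : α • E 1 + (-1 : ℝ) • E 2 = α • E 1 - E 2 := by module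
  have h4 : (1 : ℝ) • E 1 + α • E 2 = E 1 + α • E 2 := by module
  rw [← two_mul, h3, h4]
  exact h

end Heisenberg

/-! ### The algebra `2 g_{2,1}` -/

section TwoG21

variable {E : Basis (Fin 4) ℝ g}

theorem TwoG21.lie_zero (h : TwoG21 E) (x : g) : ⁅x, E 0⁆ = (-E.repr x 1) • E 0 := by
  rw [h.lie_eq]; simp

theorem TwoG21.lie_two (h : TwoG21 E) (x : g) : ⁅x, E 2⁆ = (-E.repr x 3) • E 2 := by
  rw [h.lie_eq]; simp

/-- If neither of the ideals `ℝ E₁`, `ℝ E₃` lies in `q`, then `q` is spanned by vectors `x`, `y`,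
`z` with `[y, z] = 0` for which `v = y + z` satisfies `[x, v] = x` and `[y, v] = 0`. -/
theorem TwoG21.exists_triple (h : TwoG21 E) {q : Submodule ℝ g} (hq : finrank ℝ q = 3)
    (h0 : E 0 ∉ q) (h2 : E 2 ∉ q) :
    ∃ x ∈ q, ∃ y ∈ q, ∃ v ∈ q, ⁅x, v⁆ = x ∧ ⁅y, v⁆ = 0 ∧
      ∀ a b c : ℝ, a • x + b • y + c • v = 0 → a = 0 ∧ b = 0 ∧ c = 0 := by
  obtain ⟨a, ha⟩ := exists_add_smul_mem E hq h0 (E 1)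
  obtain ⟨b, hb⟩ := exists_add_smul_mem E hq h2 (E 3)
  obtain ⟨s, hs⟩ := exists_add_smul_mem E hq h2 (E 0)
  refine ⟨_, hs, _, ha, _, add_mem ha hb, ?_, ?_, fun i j k h0 => ?_⟩
  · rw [h.lie_eq]; simp
  · rw [h.lie_eq]; simp
  · have k0 := congrArg (fun y => E.repr y 0) h0
    have k1 := congrArg (fun y => E.repr y 1) h0
    have k3 := congrArg (fun y => E.repr y 3) h0
    simp at k0 k1 k3
    subst k3
    simp at k1
    subst k1
    simpa using k0

theorem TwoG21.hasBasisWith (h : TwoG21 E) {q : Submodule ℝ g} (hq : IsGenerating q)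
    (h0 : E 0 ∉ q) (h2 : E 2 ∉ q) : HasBasisWith (NonzeroParallel 2) q := by
  obtain ⟨x, hx, y, hy, v, hv, hxv, hyv, hli⟩ := h.exists_triple hq.1 h0 h2
  have huv : ⁅x + y, v⁆ = x := by rw [add_lie, hxv, hyv, add_zero]
  have hvx : ⁅v, x⁆ = (-1 : ℝ) • x := by rw [← lie_skew, hxv, neg_one_smul]
  obtain ⟨e, he, e0, e1, e2⟩ := exists_isAdapted E hq (add_mem hx hy) hv hx (fun a b c h0 => by
      obtain ⟨h1, h2, h3⟩ := hli (a + c) a b (by rw [← h0]; module)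
      exact ⟨h2, h3, by linarith⟩)
    (by rw [huv]; exact hx) (by rw [hvx]; exact q.smul_mem _ hx)
  exact ⟨e, he, by rw [e0, e1, e2, huv], -1, by norm_num, by rw [e1, e2, hvx]⟩

theorem TwoG21.hasCommutingBasisWith (h : TwoG21 E) {q : Submodule ℝ g} (hq : IsGenerating q)
    (h0 : E 0 ∉ q) (h2 : E 2 ∉ q) : HasCommutingBasisWith (NonzeroParallel 2) q := by
  obtain ⟨x, hx, y, hy, v, hv, hxv, hyv, hli⟩ := h.exists_triple hq.1 h0 h2
  have hvx : ⁅v, x⁆ = (-1 : ℝ) • x := by rw [← lie_skew, hxv, neg_one_smul]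
  obtain ⟨e, he, e0, e1, e2⟩ := exists_isAdapted E hq hy hv hx (fun a b c h0 => by
      obtain ⟨h1, h2, h3⟩ := hli c a b (by rw [← h0]; module)
      exact ⟨h2, h3, h1⟩)
    (by rw [hyv]; exact q.zero_mem) (by rw [hvx]; exact q.smul_mem _ hx)
  exact ⟨e, he, by rw [e0, e1, hyv], -1, by norm_num, by rw [e1, e2, hvx]⟩

theorem TwoG21.possibleCases (h : TwoG21 E) :
    PossibleCases (g := g) ![ContainsIdeal, HasBasisWith (NonzeroParallel 2)] ∧
      PossibleCases (g := g) ![ContainsIdeal, HasCommutingBasisWith (NonzeroParallel 2)] := by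
  have hid0 : ∀ q : Submodule ℝ g, E 0 ∈ q → ContainsIdeal q := fun q hq =>
    containsIdeal_of_vector (E.ne_zero 0) hq fun x => ⟨_, h.lie_zero x⟩
  have hid2 : ∀ q : Submodule ℝ g, E 2 ∈ q → ContainsIdeal q := fun q hq =>
    containsIdeal_of_vector (E.ne_zero 2) hq fun x => ⟨_, h.lie_two x⟩
  have hgen1 := isGenerating_span E (u := E 1 + E 2) (v := E 0) (w := E 3) (by
    apply linearIndependent_of_minors_ne_zero E
    rw [h.lie_eq]
    simp)
  have hgen2 := isGenerating_span E (u := E 0 + E 2) (v := E 3) (w := E 1) (by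
    apply linearIndependent_of_minors_ne_zero E
    rw [h.lie_eq]
    simp)
  have hn0 : E 0 ∉ Submodule.span ℝ {E 0 + E 2, E 3, E 1} := by
    rw [Submodule.mem_span_triple]
    rintro ⟨a, b, c, habc⟩
    have k0 := congrArg (fun y => E.repr y 0) habc
    have k2 := congrArg (fun y => E.repr y 2) habc
    simp at k0 k2
    simp [k0] at k2
  have hn2 : E 2 ∉ Submodule.span ℝ {E 0 + E 2, E 3, E 1} := by
    rw [Submodule.mem_span_triple]
    rintro ⟨a, b, c, habc⟩
    have k0 := congrArg (fun y => E.repr y 0) habc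
    have k2 := congrArg (fun y => E.repr y 2) habc
    simp at k0 k2
    simp [k0] at k2
  have hor : ∀ P : Submodule ℝ g → Prop,
      (∀ q, IsGenerating q → E 0 ∉ q → E 2 ∉ q → P q) →
      ∀ q, IsGenerating q → ContainsIdeal q ∨ P q := by
    intro P hP q hq
    by_cases h0 : E 0 ∈ q
    · exact Or.inl (hid0 q h0)
    by_cases h2 : E 2 ∈ q
    · exact Or.inl (hid2 q h2)
    exact Or.inr (hP q hq h0 h2)
  constructor
  · exact possibleCases_two (hor _ fun q => h.hasBasisWith)
      (fun q hq => not_hasBasisWith_of_containsIdeal hq _)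
      ⟨_, hgen1, hid0 _ (Submodule.subset_span (by simp))⟩
      ⟨_, hgen2, h.hasBasisWith hgen2 hn0 hn2⟩
  · refine possibleCases_two (hor _ fun q => h.hasCommutingBasisWith) (fun q hq => ?_)
      ⟨_, hgen1, hid0 _ (Submodule.subset_span (by simp))⟩
      ⟨_, hgen2, h.hasCommutingBasisWith hgen2 hn0 hn2⟩
    obtain ⟨v, hv, hvq, hid⟩ := hq.exists_vector
    exact not_hasCommutingBasisWith hv hvq hid

end TwoG21

/-! ### The algebras `g_{3,6} ⊕ g_1` and `g_{3,7} ⊕ g_1` -/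

section Simple

variable {E : Basis (Fin 4) ℝ g} {ε : ℝ}

/-- The common form of `g_{3,6} ⊕ g_1` (`ε = -1`) and `g_{3,7} ⊕ g_1` (`ε = 1`). -/
def IsSimpleSum (ε : ℝ) (E : Basis (Fin 4) ℝ g) : Prop :=
  HasBrackets E (ε • E 2) (-E 1) 0 (E 0) 0 0

theorem G36G1.isSimpleSum (h : G36G1 E) : IsSimpleSum (-1) E := by
  unfold IsSimpleSum
  rw [neg_one_smul]
  exact h

theorem G37G1.isSimpleSum (h : G37G1 E) : IsSimpleSum 1 E := by
  unfold IsSimpleSum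
  rw [one_smul]
  exact h

theorem IsSimpleSum.lie_three (h : IsSimpleSum ε E) (x : g) : ⁅x, E 3⁆ = 0 := by
  rw [h.lie_eq]; simp

/-- If `q` has the basis `Fᵢ = Eᵢ + aᵢ E₄` (`i = 1, 2, 3`), the second vector of an adapted basis is
`v = a₁ F₁ + a₂ F₂ + ε a₃ F₃`. The eigenvalues of `ad v` on `q` are `0` and the square roots of
`-κ`, where `κ = ε (a₁² + a₂²) + a₃²` is the value on `v` of an invariant quadratic form. If
`κ ≠ 0`, then `[e₂, e₃] ∥ e₁` can be reached, and if `κ = 0`, then `ad v` is nilpotent and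
`[e₂, e₃] ∥ e₂`. -/
theorem IsSimpleSum.hasBasisWith (h : IsSimpleSum ε E) (hε : ε * ε = 1) {q : Submodule ℝ g}
    (hq : IsGenerating q) {a b c : ℝ} (ha : E 0 + a • E 3 ∈ q) (hb : E 1 + b • E 3 ∈ q)
    (hc : E 2 + c • E 3 ∈ q) (habc : a ≠ 0 ∨ b ≠ 0 ∨ c ≠ 0) :
    (ε * (a * a + b * b) + c * c ≠ 0 → HasBasisWith (NonzeroParallel 0) q) ∧
      (ε * (a * a + b * b) + c * c = 0 → HasBasisWith (NonzeroParallel 1) q) := by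
  have hε0 : ε ≠ 0 := by rintro rfl; simp at hε
  obtain ⟨F0, hF0⟩ : ∃ F, F = E 0 + a • E 3 := ⟨_, rfl⟩
  obtain ⟨F1, hF1⟩ : ∃ F, F = E 1 + b • E 3 := ⟨_, rfl⟩
  obtain ⟨F2, hF2⟩ : ∃ F, F = E 2 + c • E 3 := ⟨_, rfl⟩
  obtain ⟨v, hv⟩ : ∃ v, v = a • F0 + b • F1 + (ε * c) • F2 := ⟨_, rfl⟩
  have h0 : ⁅F0, v⁆ = (ε * b) • F2 - (ε * c) • F1 := by
    rw [h.lie_eq]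
    simp [hv, hF0, hF1, hF2]
    module
  have h1 : ⁅F1, v⁆ = (ε * c) • F0 - (ε * a) • F2 := by
    rw [h.lie_eq]
    simp [hv, hF0, hF1, hF2]
    module
  have h2 : ⁅F2, v⁆ = a • F1 - b • F0 := by
    rw [h.lie_eq]
    simp [hv, hF0, hF1, hF2]
    module
  rw [← hF0] at ha
  rw [← hF1] at hb
  rw [← hF2] at hc
  have hli : ∀ x y z : ℝ, x • F0 + y • F1 + z • F2 = 0 → x = 0 ∧ y = 0 ∧ z = 0 := by
    intro x y z h0
    have k0 := congrArg (fun y => E.repr y 0) h0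
    have k1 := congrArg (fun y => E.repr y 1) h0
    have k2 := congrArg (fun y => E.repr y 2) h0
    simp [hF0, hF1, hF2] at k0 k1 k2
    exact ⟨k0, k1, k2⟩
  have hvq : v ∈ q := by
    rw [hv]
    exact add_mem (add_mem (q.smul_mem _ ha) (q.smul_mem _ hb)) (q.smul_mem _ hc)
  by_cases hab : a = 0 ∧ b = 0
  · obtain ⟨rfl, rfl⟩ := hab
    have hc0 : c ≠ 0 := by simpa using habc
    simp only [zero_smul, zero_add, mul_zero, zero_sub, sub_zero] at hv h0 h1 h2
    have hw : -((ε * c) • F1) ∈ q := neg_mem (q.smul_mem _ hb)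
    have hvw : ⁅v, -((ε * c) • F1)⁆ = (c * c) • F0 := by
      rw [← lie_skew, neg_lie, neg_neg, smul_lie, h1, smul_smul]
      congr 1
      linear_combination c * c * hε
    refine ⟨fun _ => ?_, fun h => absurd h (by simpa using hc0)⟩
    obtain ⟨e, he, e0, e1, e2⟩ := exists_isAdapted E hq ha hvq hw (fun x y z h0 => by
        obtain ⟨h1, h2, h3⟩ := hli x (-(z * (ε * c))) (y * (ε * c))
          (by rw [← h0, hv]; module)
        have hεc := mul_ne_zero hε0 hc0
        refine ⟨h1, (mul_eq_zero_iff_right hεc).1 h3, (mul_eq_zero_iff_right hεc).1 (by linarith)⟩)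
      (by rw [h0]; exact hw) (by rw [hvw]; exact q.smul_mem _ ha)
    exact ⟨e, he, by rw [e0, e1, e2, h0], c * c, mul_self_ne_zero.2 hc0,
      by rw [e0, e1, e2, hvw]⟩
  · have hab' : a * a + b * b ≠ 0 := fun h => hab <| by
      constructor <;> nlinarith [mul_self_nonneg a, mul_self_nonneg b]
    have hw : a • F1 - b • F0 ∈ q := sub_mem (q.smul_mem _ hb) (q.smul_mem _ ha)
    have hvw : ⁅v, a • F1 - b • F0⁆ =
        (ε * (a * a + b * b) + c * c) • F2 - (ε * c) • v := by
      rw [← lie_skew, sub_lie, smul_lie, smul_lie, h0, h1, hv]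
      have : c * c = (ε * c) * (ε * c) := by linear_combination -(c * c) * hε
      rw [this]
      module
    have huv : ∀ d : ℝ, ⁅F2 - d • v, v⁆ = a • F1 - b • F0 := fun d => by
      rw [sub_lie, smul_lie, lie_self, smul_zero, sub_zero, h2]
    -- subtracting `d • v` from `F2` leaves `[u, v]` unchanged; for `d = ε c / κ`, with `κ ≠ 0`, it
    -- makes `[v, [u, v]]` equal to `κ u`
    have hbasis := fun d : ℝ => exists_isAdapted E hq (u := F2 - d • v)
      (sub_mem hc (q.smul_mem _ hvq)) hvq hw (fun x y z h0 => by
        obtain ⟨h1, h2, h3⟩ := hli ((y - x * d) * a - z * b) ((y - x * d) * b + z * a)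
          (x + (y - x * d) * (ε * c)) (by rw [← h0, hv]; module)
        have hz : z = 0 := (mul_eq_zero_iff_right hab').1 (by linear_combination a * h2 - b * h1)
        have hy : y - x * d = 0 :=
          (mul_eq_zero_iff_right hab').1 (by linear_combination a * h1 + b * h2)
        rw [hy, zero_mul, add_zero] at h3
        rw [h3, zero_mul, sub_zero] at hy
        exact ⟨h3, hy, hz⟩)
      (by rw [huv]; exact hw)
      (by rw [hvw]; exact sub_mem (q.smul_mem _ hc) (q.smul_mem _ hvq))
    constructor
    · intro hκ
      obtain ⟨e, he, e0, e1, e2⟩ := hbasis (ε * c / (ε * (a * a + b * b) + c * c))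
      refine ⟨e, he, by rw [e0, e1, e2, huv], _, hκ, ?_⟩
      rw [e0, e1, e2, hvw, smul_sub, smul_smul, mul_div_cancel₀ _ hκ]
    · intro hκ
      obtain ⟨e, he, e0, e1, e2⟩ := hbasis 0
      refine ⟨e, he, by rw [e0, e1, e2, huv], -(ε * c), ?_, ?_⟩
      · refine neg_ne_zero.2 (mul_ne_zero hε0 ?_)
        rintro rfl
        exact mul_ne_zero hε0 hab' (by linarith)
      · rw [e1, e2, hvw, hκ, zero_smul, zero_sub, neg_smul]

/-- A hyperplane complementary to the center `ℝ E₄` which is not a subalgebra is the graph of a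
nonzero functional on `⟨E₁, E₂, E₃⟩`. -/
theorem IsSimpleSum.exists_graph (h : IsSimpleSum ε E) {q : Submodule ℝ g}
    (hq : IsGenerating q) (hE : E 3 ∉ q) :
    ∃ a b c : ℝ, E 0 + a • E 3 ∈ q ∧ E 1 + b • E 3 ∈ q ∧ E 2 + c • E 3 ∈ q ∧
      (a ≠ 0 ∨ b ≠ 0 ∨ c ≠ 0) := by
  obtain ⟨a, ha⟩ := exists_add_smul_mem E hq.1 hE (E 0)
  obtain ⟨b, hb⟩ := exists_add_smul_mem E hq.1 hE (E 1)
  obtain ⟨c, hc⟩ := exists_add_smul_mem E hq.1 hE (E 2)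
  refine ⟨a, b, c, ha, hb, hc, ?_⟩
  by_contra! habc
  obtain ⟨rfl, rfl, rfl⟩ := habc
  rw [zero_smul, add_zero] at ha hb hc
  refine hq.not_forall_lie_mem E fun x _ y _ => ?_
  rw [h.lie_eq]
  simp only [smul_zero, add_zero]
  exact add_mem (add_mem (q.smul_mem _ (q.smul_mem _ hc)) (q.smul_mem _ (neg_mem hb)))
    (q.smul_mem _ ha)

theorem IsSimpleSum.exists_mem (h : IsSimpleSum ε E) (hε : ε ≠ 0) :
    ∃ q : Submodule ℝ g, IsGenerating q ∧ E 3 ∈ q := by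
  refine ⟨_, isGenerating_span E (u := E 0) (v := E 3) (w := E 1) ?_,
    Submodule.subset_span (by simp)⟩
  apply linearIndependent_of_minors_ne_zero E
  rw [h.lie_eq]
  simpa using hε

theorem IsSimpleSum.exists_hasBasisWith_parallel_first (h : IsSimpleSum ε E) (hε : ε * ε = 1) :
    ∃ q : Submodule ℝ g, IsGenerating q ∧ HasBasisWith (NonzeroParallel 0) q := by
  have hε0 : ε ≠ 0 := by rintro rfl; simp at hε
  have hgen := isGenerating_span E (u := E 0) (v := E 2 + E 3) (w := E 1) (by
    apply linearIndependent_of_minors_ne_zero E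
    rw [h.lie_eq]
    simpa using hε0)
  refine ⟨_, hgen, (h.hasBasisWith hε hgen (a := 0) (b := 0) (c := 1) ?_ ?_ ?_ ?_).1 ?_⟩
  · exact Submodule.subset_span (by simp)
  · exact Submodule.subset_span (by simp)
  · exact Submodule.subset_span (by simp)
  · simp
  · simp

theorem IsSimpleSum.central_eq_smul (h : IsSimpleSum ε E) (hε : ε ≠ 0) (x : g)
    (hx : ∀ y : g, ⁅y, x⁆ = 0) : ∃ c : ℝ, x = c • E 3 := by
  have hx1 := hx (E 0)
  have hx2 := hx (E 1)
  rw [h.lie_eq] at hx1 hx2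
  have k1 := congrArg (fun y => E.repr y 2) hx1
  have k2 := congrArg (fun y => E.repr y 1) hx1
  have k0 := congrArg (fun y => E.repr y 2) hx2
  simp [hε] at k0 k1 k2
  exact ⟨E.repr x 3, by apply Basis.ext_repr_four E <;> simp [k0, k1, k2]⟩

/-- `ad e₂` is nilpotent on `q` if `[e₂, e₃] ∥ e₂`, and it is not if `0 ≠ [e₂, e₃] ∥ e₁`; as the
line `ℝ e₂` is determined by `q`, both cannot happen. -/
theorem not_hasBasisWith_parallel_first {q : Submodule ℝ g}
    (h : HasBasisWith (NonzeroParallel 1) q) : ¬ HasBasisWith (NonzeroParallel 0) q := by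
  obtain ⟨e, he, h2, c, -, hc⟩ := h
  rintro ⟨f, hf, f2, d, hd, hd'⟩
  have hmem : ∀ i : Fin 4, i ≠ 3 → f i ∈ q := by
    intro i hi
    rw [← hf.span_eq]
    apply Submodule.subset_span
    fin_cases i <;> simp at hi ⊢
  have h10 : ⁅f 1, f 0⁆ = -f 2 := by rw [← lie_skew, f2]
  obtain ⟨b, hb, hfe⟩ := he.eq_smul_second (f.ne_zero 1) (hmem 1 (by decide)) (fun x hx => by
    rw [← hf.span_eq] at hx
    obtain ⟨x0, x1, x2, rfl⟩ := Submodule.mem_span_triple.1 hx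
    have h21 : ⁅f 2, f 1⁆ = -(d • f 0) := by rw [← lie_skew, hd']
    rw [add_lie, add_lie, smul_lie, smul_lie, smul_lie, lie_self, ← f2, h21]
    exact add_mem (add_mem (q.smul_mem _ (hmem 2 (by decide))) (q.smul_mem _ q.zero_mem))
      (q.smul_mem _ (neg_mem (q.smul_mem _ (hmem 0 (by decide))))))
  have hnil : ∀ x ∈ q, ⁅e 1, ⁅e 1, ⁅e 1, x⁆⁆⁆ = 0 := by
    intro x hx
    rw [← he.span_eq] at hx
    obtain ⟨x0, x1, x2, rfl⟩ := Submodule.mem_span_triple.1 hx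
    have e10 : ⁅e 1, e 0⁆ = -e 2 := by rw [← lie_skew, h2]
    simp [lie_add, lie_smul, e10, hc, -lie_skew]
  have hf3 : ⁅f 1, ⁅f 1, ⁅f 1, f 2⁆⁆⁆ = -((d * d) • f 0) := by
    rw [hd', lie_smul, h10, lie_smul, lie_neg, hd', smul_neg, smul_smul]
  rw [hfe] at hf3
  simp only [smul_lie, lie_smul] at hf3
  rw [hnil _ (hmem 2 (by decide)), smul_zero, smul_zero, smul_zero, eq_comm, neg_eq_zero] at hf3
  exact smul_ne_zero (mul_self_ne_zero.2 hd) (f.ne_zero 0) hf3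

theorem G36G1.possibleCases (h : G36G1 E) :
    PossibleCases (g := g) ![fun q => Submodule.span ℝ {E 3} ≤ q,
      HasBasisWith (NonzeroParallel 1), HasBasisWith (NonzeroParallel 0)] := by
  have h' := h.isSimpleSum
  have hex : ∀ P (q : Submodule ℝ g), Submodule.span ℝ {E 3} ≤ q → ¬ HasBasisWith P q :=
    fun P q hq => not_hasBasisWith (E.ne_zero 3)
      ((Submodule.span_singleton_le_iff_mem _ _).1 hq)
      (fun x => ⟨0, by rw [h'.lie_three, zero_smul]⟩) P
  obtain ⟨q₁, hq₁, hE₁⟩ := h'.exists_mem (by norm_num)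
  refine possibleCases_three (fun q hq => ?_) (fun q _ => hex _ q) (hex _)
    (fun q => not_hasBasisWith_parallel_first)
    ⟨q₁, hq₁, (Submodule.span_singleton_le_iff_mem _ _).2 hE₁⟩ ?_
    (h'.exists_hasBasisWith_parallel_first (by norm_num))
  · by_cases hE : E 3 ∈ q
    · exact Or.inl ((Submodule.span_singleton_le_iff_mem _ _).2 hE)
    obtain ⟨a, b, c, ha, hb, hc, habc⟩ := h'.exists_graph hq hE
    obtain ⟨k0, k1⟩ := h'.hasBasisWith (by norm_num) hq ha hb hc habc
    rcases eq_or_ne ((-1 : ℝ) * (a * a + b * b) + c * c) 0 with hκ | hκ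
    · exact Or.inr (Or.inl (k1 hκ))
    · exact Or.inr (Or.inr (k0 hκ))
  · -- the functional `(1, 0, 1)` is a zero of `κ = -(a² + b²) + c²`
    have hgen := isGenerating_span E (u := E 0 + E 3) (v := E 2 + E 3) (w := E 1) (by
      apply linearIndependent_of_minors_ne_zero E
      rw [h.lie_eq]
      simp)
    refine ⟨_, hgen, (h'.hasBasisWith (by norm_num) hgen (a := 1) (b := 0) (c := 1)
      ?_ ?_ ?_ ?_).2 ?_⟩
    · exact Submodule.subset_span (by simp)
    · exact Submodule.subset_span (by simp)
    · exact Submodule.subset_span (by simp)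
    · simp
    · norm_num

theorem G37G1.possibleCases (h : G37G1 E) :
    PossibleCases (g := g) ![ContainsCenter, HasBasisWith (NonzeroParallel 0)] := by
  have h' := h.isSimpleSum
  have hcen := h'.central_eq_smul one_ne_zero
  obtain ⟨q₁, hq₁, hE₁⟩ := h'.exists_mem one_ne_zero
  refine possibleCases_two (fun q hq => ?_)
    (fun q hq => not_hasBasisWith_of_containsCenter hq (E.ne_zero 3) h'.lie_three _)
    ⟨q₁, hq₁, containsCenter_of_mem hE₁ hcen⟩
    (h'.exists_hasBasisWith_parallel_first (by norm_num))
  by_cases hE : E 3 ∈ q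
  · exact Or.inl (containsCenter_of_mem hE hcen)
  obtain ⟨a, b, c, ha, hb, hc, habc⟩ := h'.exists_graph hq hE
  refine Or.inr ((h'.hasBasisWith (by norm_num) hq ha hb hc habc).1 fun hκ => ?_)
  have h0 : a = 0 ∧ b = 0 ∧ c = 0 := by
    refine ⟨?_, ?_, ?_⟩ <;>
      nlinarith [mul_self_nonneg a, mul_self_nonneg b, mul_self_nonneg c]
  simp [h0] at habc

end Simple

end FourDimLie

theorem theorem4 {g : Type*} [LieRing g] [LieAlgebra ℝ g] (E : Module.Basis (Fin 4) ℝ g) :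
    -- 1
    (TwoG21 E →
      PossibleCases (g := g) ![ContainsIdeal, HasBasisWith (NonzeroParallel 2)] ∧
      PossibleCases (g := g) ![ContainsIdeal, HasCommutingBasisWith (NonzeroParallel 2)]) ∧
    -- 2
    ((G32G1 E ∨ (∃ α : ℝ, 0 ≤ α ∧ α ≠ 1 ∧ G34G1 α E) ∨ G43 E) →
      PossibleCases (g := g) ![ContainsCenter, ContainsNoncentralIdeal,
        HasBasisWith fun e => ⁅e 1, e 2⁆ = 0]) ∧
    -- 3
    (((∃ α : ℝ, 0 ≤ α ∧ G35G1 α E) ∨ G41 E) →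
      PossibleCases (g := g) ![ContainsCenter, HasBasisWith fun e => ⁅e 1, e 2⁆ = 0]) ∧
    -- 4
    (G36G1 E →
      PossibleCases (g := g) ![fun q => Submodule.span ℝ {E 3} ≤ q,
        HasBasisWith (NonzeroParallel 1), HasBasisWith (NonzeroParallel 0)]) ∧
    -- 5
    (G37G1 E →
      PossibleCases (g := g) ![ContainsCenter, HasBasisWith (NonzeroParallel 0)]) ∧
    -- 6
    (((∃ α : ℝ, α ≠ 0 ∧ α ≠ 1 ∧ G42 α E) ∨ G44 E ∨
        (∃ α β : ℝ, ((-1 < α ∧ α < β ∧ β < 1 ∧ α * β ≠ 0) ∨ (α = -1 ∧ 0 < β ∧ β < 1)) ∧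
          G45 α β E) ∨
        (∃ α β : ℝ, 0 < α ∧ G46 α β E)) →
      PossibleCases (g := g) ![ContainsNoncentralIdeal,
        HasBasisWith fun e => ⁅e 1, e 2⁆ = 0]) ∧
    (G45 (-1) 1 E →
      (∃ q : Submodule ℝ g, IsGenerating q) ∧
      ∀ q : Submodule ℝ g, IsGenerating q →
        ContainsNoncentralIdeal q ∧ ¬ HasBasisWith (fun e => ⁅e 1, e 2⁆ = 0) q) ∧
    -- 7
    ((G47 E ∨ (∃ α : ℝ, -1 < α ∧ α < 1 ∧ α ≠ 0 ∧ G48 α E) ∨ (∃ α : ℝ, 0 < α ∧ G49 α E)) →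
      PossibleCases (g := g) ![ContainsNoncentralIdeal,
        HasBasisWith fun e => structConst e 1 2 0 ≠ 0 ∧ structConst e 1 2 1 = 0]) ∧
    -- 8
    ((G48 (-1) E ∨ G49 0 E) →
      PossibleCases (g := g) ![ContainsCenter,
        HasBasisWith fun e => structConst e 1 2 0 ≠ 0 ∧ structConst e 1 2 1 = 0]) ∧
    -- 9
    (G48 0 E →
      PossibleCases (g := g) ![ContainsNoncentralIdeal,
        HasBasisWith fun e => structConst e 1 2 0 = 0 ∧ structConst e 1 2 1 = 0]) := by
  refine ⟨fun h => h.possibleCases, ?_, ?_, fun h => h.possibleCases, fun h => h.possibleCases,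
    ?_, fun h => h.containsNoncentralIdeal_of_isGenerating, ?_, ?_, ?_⟩
  · rintro (h | ⟨α, h0, h1, h⟩ | h)
    · exact h.possibleCases
    · exact h.possibleCases h0 h1
    · exact h.possibleCases
  · rintro (⟨α, -, h⟩ | h)
    · exact h.possibleCases
    · exact h.possibleCases
  · rintro (⟨α, h0, h1, h⟩ | h | ⟨α, β, hαβ, h⟩ | ⟨α, β, hα, h⟩)
    · exact h.possibleCases h0 h1
    · exact h.possibleCases
    · rcases hαβ with ⟨-, h1, h2, h3⟩ | ⟨rfl, h1, h2⟩
      · exact h.possibleCases (left_ne_zero_of_mul h3) (right_ne_zero_of_mul h3) h1.ne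
          (h1.trans h2).ne h2.ne
      · exact h.possibleCases (by norm_num) h1.ne' (by linarith : (-1 : ℝ) < β).ne (by norm_num)
          h2.ne
    · exact h.possibleCases hα
  · rintro (h | ⟨α, h0, h1, h2, h⟩ | ⟨α, hα, h⟩)
    · exact h.isHeisenbergExtension.possibleCases_ideal (m := 0) (n := 1) (by norm_num)
        (by norm_num) fun e he => ⟨by rw [he.1]; norm_num, he.2⟩
    · exact h.isHeisenbergExtension.possibleCases_ideal (m := 1) (n := 1)
        (by simpa [sub_eq_zero] using h1.ne) (by linarith : 0 < 1 + α).ne'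
        fun e he => ⟨by rw [he.1]; simpa using h2, he.2⟩
    · exact h.isHeisenbergExtension.possibleCases_ideal (m := 0) (n := 1) (by norm_num)
        (by positivity) fun e he => ⟨by rw [he.1]; nlinarith, he.2⟩
  · rintro (h | h)
    · exact h.isHeisenbergExtension.possibleCases_center (m := 1) (n := 1) (by norm_num)
        (by norm_num) fun e he => ⟨by rw [he.1]; norm_num, he.2⟩
    · exact h.isHeisenbergExtension.possibleCases_center (m := 0) (n := 1) (by norm_num)
        (by norm_num) fun e he => ⟨by rw [he.1]; norm_num, he.2⟩
  · intro h
    exact h.isHeisenbergExtension.possibleCases_ideal (m := 1) (n := 1) (by norm_num)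
      (by norm_num) fun e he => ⟨by rw [he.1]; norm_num, he.2⟩
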